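/- **Definitions.** A *differential space* is a topological space $P$ with a ring $C^\infty(P)$ of real functions such that the sets $f^{-1}((a,b))$, $f\in C^\infty(P)$, form a sub-basis of the topology, $F(f_1,\dots,f_k)\in C^\infty(P)$ whenever $f_i\in C^\infty(P)$ and $F\in C^\infty(\mathbb R^k)$, and every function that locally agrees with functions in $C^\infty(P)$ is in $C^\infty(P)$. A subset of $P$ carries the differential structure of functions that locally are restrictions of functions in $C^\infty(P)$; maps are smooth if they pull smooth functions back to smooth functions. $P$ is *subcartesian* if it is Hausdorff and each point has a neighbourhood diffeomorphic to a subset of some $\mathbb R^N$. For a derivation $X$ of $C^\infty(P)$, $(\exp tX)(x)$ denotes the value at time $t$, if it exists, of the integral curve of $X$ starting at $x$. $X$ is a *vector field* on $P$ if each point has an open neighbourhood $U$ and an $\varepsilon>0$ such that, for $|t|<\varepsilon$, $\exp tX$ is defined on $U$ and is a diffeomorphism of $U$ onto an open subset of $P$. The *orbit* $O_x$ of $x\in P$ is the set of all points $(\exp t_1X_1\circ\dots\circ\exp t_kX_k)(x)$ with $X_1,\dots,X_k$ vector fields on $P$, and its *manifold topology* is the finest one in which all maps $(t_1,\dots,t_k)\mapsto(\exp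 t_1X_1\circ\dots\circ\exp t_kX_k)(x)$ are continuous on their domains. A *smooth stratification* of $P$ is a locally finite partition $\mathcal D$ of $P$ into connected smooth manifolds $M$, each of which, with its manifold topology, is a locally closed topological subspace of $P$ whose inclusion in $P$ is smooth and an immersion (i.e. the smooth functions on $M$ are exactly the functions that locally are restrictions of functions in $C^\infty(P)$), such that the *Frontier Condition* holds: for $M,M'\in\mathcal D$, if $M'\cap\overline M\ne\emptyset$, then $M'=M$ or $M'\subset\overline M\setminus M$. (Manifolds are not required to be second countable, but all manifolds below are Hausdorff.) **Theorem.** Let $P$ be a subcartesian space and let $\mathcal O$ be the family of orbits of the family of all vector fields on $P$. Suppose that $\mathcal O$ is locally finite and that each orbit is a locally closed subset of $P$. Then 1. $\mathcal O$ is a partition of $P$ that satisfies the Frontier Condition, and each orbit, with its manifold topology, is connected and is a smooth manifold whose inclusion in $P$ is continuous, smooth and an immersion (i.e. the smooth functions on the orbit are exactly those that, locally in the manifold topology, are restrictions of functions in $C^\infty(P)$); 2. if moreover the manifold topology of each orbit is its topology as a subspace of $P$ (so that each orbit, with its manifold topology, is a locally closed topological subspace of $P$), then $\mathcal O$ is a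 smooth stratification of $P$. -/

import Mathlib

open Set Filter Topology
open scoped ContDiff Manifold

noncomputable section

/-! ### Differential spaces -/

/-- A differential structure on a topological space `P`: a subalgebra of real-valued functions
which generates the topology, is closed under composition with smooth functions of several real
variables, and is local. -/
class DifferentialSpace (P : Type*) [TopologicalSpace P] where
  /-- The algebra of smooth functions on `P`. -/
  smoothFun : Subalgebra ℝ (P → ℝ)
  generate : ‹TopologicalSpace P› =
    TopologicalSpace.generateFrom {V | ∃ f ∈ smoothFun, ∃ a b : ℝ, V = f ⁻¹' Ioo a b}
  comp_mem : ∀ (k : ℕ) (f : Fin k → P → ℝ) (F : (Fin k → ℝ) → ℝ),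
    (∀ i, f i ∈ smoothFun) → ContDiff ℝ ∞ F → (fun x => F (fun i => f i x)) ∈ smoothFun
  local_mem : ∀ f : P → ℝ,
    (∀ x, ∃ U : Set P, IsOpen U ∧ x ∈ U ∧ ∃ g ∈ smoothFun, EqOn f g U) → f ∈ smoothFun

/-- The algebra `C^∞(P)` of smooth functions on a differential space. -/
abbrev SmoothFn (P : Type*) [TopologicalSpace P] [DifferentialSpace P] : Subalgebra ℝ (P → ℝ) :=
  DifferentialSpace.smoothFun

theorem SmoothFn.continuous {P : Type*} [TopologicalSpace P] [DifferentialSpace P] {f : P → ℝ}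
    (hf : f ∈ SmoothFn P) : Continuous f := by
  have hb : ∀ a b : ℝ, IsOpen (f ⁻¹' Ioo a b) := fun a b => by
    have h := DifferentialSpace.generate (P := P)
    rw [h]
    exact TopologicalSpace.isOpen_generateFrom_of_mem ⟨f, hf, a, b, rfl⟩
  refine continuous_iff_continuousAt.2 fun x => Metric.tendsto_nhds.2 fun ε hε => ?_
  have h1 : f ⁻¹' Ioo (f x - ε) (f x + ε) ∈ 𝓝 x :=
    (hb _ _).mem_nhds ⟨by linarith, by linarith⟩
  filter_upwards [h1] with y hy
  rw [Real.dist_eq, abs_lt]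
  constructor <;> linarith [hy.1, hy.2]

/-- A map of differential spaces is smooth if it pulls smooth functions back to smooth
functions. -/
def IsSmoothMap {P Q : Type*} [TopologicalSpace P] [DifferentialSpace P]
    [TopologicalSpace Q] [DifferentialSpace Q] (φ : P → Q) : Prop :=
  ∀ g ∈ SmoothFn Q, g ∘ φ ∈ SmoothFn P

/-- Diffeomorphisms of differential spaces. -/
structure DiffSpaceEquiv (P Q : Type*) [TopologicalSpace P] [DifferentialSpace P]
    [TopologicalSpace Q] [DifferentialSpace Q] extends P ≃ₜ Q where
  smooth_toFun : IsSmoothMap toFun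
  smooth_invFun : IsSmoothMap invFun

/-- The differential structure of a subset: functions that locally are restrictions of smooth
functions on the ambient space. -/
instance DifferentialSpace.instSubset {P : Type*} [TopologicalSpace P] [DifferentialSpace P]
    (S : Set P) : DifferentialSpace S where
  smoothFun :=
    { carrier := {f | ∀ x : S, ∃ g ∈ SmoothFn P, ∀ᶠ y : S in 𝓝 x, f y = g y}
      mul_mem' := by
        intro f₁ f₂ h₁ h₂ x
        obtain ⟨g₁, hg₁, e₁⟩ := h₁ x
        obtain ⟨g₂, hg₂, e₂⟩ := h₂ x
        refine ⟨g₁ * g₂, mul_mem hg₁ hg₂, ?_⟩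
        filter_upwards [e₁, e₂] with y hy₁ hy₂
        simp [hy₁, hy₂]
      add_mem' := by
        intro f₁ f₂ h₁ h₂ x
        obtain ⟨g₁, hg₁, e₁⟩ := h₁ x
        obtain ⟨g₂, hg₂, e₂⟩ := h₂ x
        refine ⟨g₁ + g₂, add_mem hg₁ hg₂, ?_⟩
        filter_upwards [e₁, e₂] with y hy₁ hy₂
        simp [hy₁, hy₂]
      algebraMap_mem' := fun r x =>
        ⟨algebraMap ℝ (P → ℝ) r, Subalgebra.algebraMap_mem _ r, Eventually.of_forall fun _ => rfl⟩ }
  generate := by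
    apply le_antisymm
    · refine le_generateFrom ?_
      rintro _ ⟨f, hf, a, b, rfl⟩
      have hc : Continuous f := by
        refine continuous_iff_continuousAt.2 fun x => ?_
        obtain ⟨g, hg, e⟩ := hf x
        exact (((SmoothFn.continuous hg).comp continuous_subtype_val).continuousAt).congr
          (e.mono fun y hy => hy.symm)
      exact isOpen_Ioo.preimage hc
    · have h := DifferentialSpace.generate (P := P)
      have h' : (instTopologicalSpaceSubtype : TopologicalSpace S) =
          TopologicalSpace.induced Subtype.val (TopologicalSpace.generateFrom
            {V | ∃ f ∈ SmoothFn P, ∃ a b : ℝ, V = f ⁻¹' Ioo a b}) := by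
        rw [← h]; rfl
      rw [h', induced_generateFrom_eq]
      refine le_generateFrom ?_
      rintro _ ⟨_, ⟨f, hf, a, b, rfl⟩, rfl⟩
      exact TopologicalSpace.isOpen_generateFrom_of_mem
        ⟨fun y => f y, fun x => ⟨f, hf, Eventually.of_forall fun _ => rfl⟩, a, b, rfl⟩
  comp_mem := by
    intro k f F hf hF x
    choose g hg e using fun i => hf i x
    refine ⟨fun y => F (fun i => g i y), DifferentialSpace.comp_mem k g F hg hF, ?_⟩
    filter_upwards [eventually_all.2 e] with y hy
    simp [hy]
  local_mem := by
    intro f hf x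
    obtain ⟨U, hU, hx, h, hh, e⟩ := hf x
    obtain ⟨g, hg, e'⟩ := hh x
    refine ⟨g, hg, ?_⟩
    filter_upwards [hU.mem_nhds hx, e'] with y hy hy'
    rw [e hy, hy']

/-- The algebra of smooth functions on `ℝ^N`. -/
def euclideanSmoothFn (N : ℕ) : Subalgebra ℝ (EuclideanSpace ℝ (Fin N) → ℝ) where
  carrier := {f | ContDiff ℝ ∞ f}
  mul_mem' := by
    intro f₁ f₂ h₁ h₂
    rw [mem_ofPred_eq] at *
    exact h₁.mul h₂
  add_mem' := by
    intro f₁ f₂ h₁ h₂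
    rw [mem_ofPred_eq] at *
    exact h₁.add h₂
  algebraMap_mem' := fun r =>
    (contDiff_const : ContDiff ℝ ∞ fun _ : EuclideanSpace ℝ (Fin N) => r)

theorem mem_euclideanSmoothFn {N : ℕ} {f : EuclideanSpace ℝ (Fin N) → ℝ} :
    f ∈ euclideanSmoothFn N ↔ ContDiff ℝ ∞ f := Iff.rfl

/-- The standard differential structure of `ℝ^N`. -/
instance DifferentialSpace.instEuclidean (N : ℕ) :
    DifferentialSpace (EuclideanSpace ℝ (Fin N)) where
  smoothFun := euclideanSmoothFn N
  generate := by
    apply le_antisymm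
    · refine le_generateFrom ?_
      rintro _ ⟨f, hf, a, b, rfl⟩
      exact isOpen_Ioo.preimage (mem_euclideanSmoothFn.1 hf).continuous
    · intro V hV
      let τ := TopologicalSpace.generateFrom {V : Set (EuclideanSpace ℝ (Fin N)) |
        ∃ f ∈ euclideanSmoothFn N, ∃ a b : ℝ, V = f ⁻¹' Ioo a b}
      refine (@isOpen_iff_forall_mem_open _ τ V).2 fun x hx => ?_
      obtain ⟨r, hr, hball⟩ := Metric.isOpen_iff.1 hV x hx
      refine ⟨(fun y : EuclideanSpace ℝ (Fin N) => ‖y - x‖ ^ 2) ⁻¹' Ioo (-1) (r ^ 2), ?_,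
        TopologicalSpace.isOpen_generateFrom_of_mem ⟨_, mem_euclideanSmoothFn.2
          ((contDiff_id.sub contDiff_const).norm_sq ℝ), _, _, rfl⟩, ?_⟩
      · intro y hy
        apply hball
        rw [Metric.mem_ball, dist_eq_norm]
        exact lt_of_pow_lt_pow_left₀ 2 hr.le hy.2
      · simp [hr]
  comp_mem := by
    intro k f F hf hF
    exact mem_euclideanSmoothFn.2
      (hF.comp (contDiff_pi.2 fun i => mem_euclideanSmoothFn.1 (hf i)))
  local_mem := by
    intro f hf
    refine mem_euclideanSmoothFn.2 (contDiff_iff_contDiffAt.2 fun x => ?_)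
    obtain ⟨U, hU, hx, g, hg, e⟩ := hf x
    exact (mem_euclideanSmoothFn.1 hg).contDiffAt.congr_of_eventuallyEq
      (e.eventuallyEq_of_mem (hU.mem_nhds hx))

/-- A subcartesian space: a Hausdorff differential space each point of which has a neighbourhood
diffeomorphic to a subset of some `ℝ^N`. -/
def IsSubcartesian (P : Type*) [TopologicalSpace P] [DifferentialSpace P] : Prop :=
  T2Space P ∧ ∀ x : P, ∃ U ∈ 𝓝 x, ∃ (N : ℕ) (S : Set (EuclideanSpace ℝ (Fin N))),
    Nonempty (DiffSpaceEquiv U S)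

/-! ### Vector fields and their orbits -/

section VectorFields

variable {P : Type*} [TopologicalSpace P] [DifferentialSpace P]

/-- `c` restricted to the interval `I` is an integral curve of the derivation `X`. If `I` is a
single point, the condition on the derivative is empty. -/
def IsIntegralCurveOfDerivation (X : Derivation ℝ (SmoothFn P) (SmoothFn P)) (c : ℝ → P)
    (I : Set ℝ) : Prop :=
  ∀ f : SmoothFn P, ContDiffOn ℝ ∞ (fun t => (f : P → ℝ) (c t)) I ∧
    ∀ t ∈ I, HasDerivWithinAt (fun s => (f : P → ℝ) (c s)) ((X f : P → ℝ) (c t)) I t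

/-- `ExpRel X t x y`: the integral curve of `X` starting at `x` is defined up to time `t`, and
`y` is its value there, that is, `y = (exp tX)(x)`. -/
def ExpRel (X : Derivation ℝ (SmoothFn P) (SmoothFn P)) (t : ℝ) (x y : P) : Prop :=
  ∃ c : ℝ → P, IsIntegralCurveOfDerivation X c (uIcc 0 t) ∧ c 0 = x ∧ c t = y

/-- A derivation is a vector field if translations along its integral curves form a local
one-parameter group of local diffeomorphisms: every point has an open neighbourhood `U` which,
for all small `t`, is mapped by `exp tX` diffeomorphically onto an open set. -/
def IsVectorField (X : Derivation ℝ (SmoothFn P) (SmoothFn P)) : Prop :=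
  ∀ x : P, ∃ U : Set P, IsOpen U ∧ x ∈ U ∧ ∃ ε > 0, ∀ t : ℝ, |t| < ε →
    ∃ V : Set P, IsOpen V ∧ ∃ φ : DiffSpaceEquiv U V, ∀ y : U, ExpRel X t y (φ.toHomeomorph y)

variable (P) in
/-- The family of all vector fields on `P`. -/
abbrev AllVectorFields : Type _ := {X : Derivation ℝ (SmoothFn P) (SmoothFn P) // IsVectorField X}

/-- `ComposedExpRel k X t x y`: the composition `exp t₁X₁ ∘ ⋯ ∘ exp tₖXₖ` is defined at `x` and
has the value `y` there. -/
def ComposedExpRel : (k : ℕ) → (Fin k → AllVectorFields P) → (Fin k → ℝ) → P → P → Prop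
  | 0, _, _, x, y => y = x
  | k + 1, X, t, x, y =>
    ∃ w, ComposedExpRel k (Fin.tail X) (Fin.tail t) x w ∧ ExpRel (X 0).1 (t 0) w y

/-- The orbit through `x` of the family of all vector fields on `P`. -/
def vfOrbit (x : P) : Set P :=
  {y | ∃ (k : ℕ) (X : Fin k → AllVectorFields P) (t : Fin k → ℝ), ComposedExpRel k X t x y}

variable (P) in
/-- The family of all orbits. -/
def vfOrbits : Set (Set P) := range (vfOrbit (P := P))

/-- The orbit through `x`, as a space with its own (manifold) topology. -/
def OrbitSpace (x : P) : Type _ := vfOrbit x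

/-- The inclusion of an orbit. -/
def OrbitSpace.incl (x : P) : OrbitSpace x → P := Subtype.val

/-- The manifold topology of the orbit through `x`: the finest topology for which all the maps
`(t₁, …, tₖ) ↦ (exp t₁X₁ ∘ ⋯ ∘ exp tₖXₖ)(x)` are continuous on their domains. -/
instance OrbitSpace.instTopologicalSpace (x : P) : TopologicalSpace (OrbitSpace x) where
  IsOpen A := ∀ (k : ℕ) (X : Fin k → AllVectorFields P) (t : Fin k → ℝ),
    (∃ z ∈ A, ComposedExpRel k X t x (OrbitSpace.incl x z)) →
      ∀ᶠ s in 𝓝 t, ∀ z : OrbitSpace x, ComposedExpRel k X s x (OrbitSpace.incl x z) → z ∈ A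
  isOpen_univ := fun _ _ _ _ => Eventually.of_forall fun _ _ _ => mem_univ _
  isOpen_inter := by
    rintro A B hA hB k X t ⟨z, hz, h⟩
    filter_upwards [hA k X t ⟨z, hz.1, h⟩, hB k X t ⟨z, hz.2, h⟩] with s h₁ h₂ w hw
    exact ⟨h₁ w hw, h₂ w hw⟩
  isOpen_sUnion := by
    rintro 𝒜 h𝒜 k X t ⟨z, ⟨A, hA, hz⟩, h⟩
    filter_upwards [h𝒜 A hA k X t ⟨z, hz, h⟩] with s hs w hw
    exact ⟨A, hA, hs w hw⟩

/-! ### Smooth decompositions and stratifications -/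

/-- The space `M` is a smooth manifold (of some finite dimension) for which the inclusion
`i : M → P` is smooth and an immersion: smooth functions on `P` pull back to smooth
functions on `M`, and every smooth function on `M` locally arises in this way. -/
def IsSmoothManifoldVia {M : Type*} [TopologicalSpace M] (i : M → P) : Prop :=
  ∃ (n : ℕ) (_ : ChartedSpace (EuclideanSpace ℝ (Fin n)) M), IsManifold (𝓡 n) ∞ M ∧
    (∀ f ∈ SmoothFn P, ContMDiff (𝓡 n) 𝓘(ℝ, ℝ) ∞ (f ∘ i)) ∧
    (∀ h : M → ℝ, ContMDiff (𝓡 n) 𝓘(ℝ, ℝ) ∞ h →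
      ∀ x : M, ∃ g ∈ SmoothFn P, ∀ᶠ y in 𝓝 x, h y = g (i y))

/-- The Frontier Condition for a family of subsets. -/
def FrontierCondition (𝒟 : Set (Set P)) : Prop :=
  ∀ M ∈ 𝒟, ∀ M' ∈ 𝒟, (M' ∩ closure M).Nonempty → M' = M ∨ M' ⊆ closure M \ M

/-- A smooth decomposition of `P`: a locally finite partition into smooth manifolds, each of which
is, with its manifold topology, a locally closed topological subspace of `P`, is smoothly included
in `P`, and which together satisfy the Frontier Condition. -/
structure IsSmoothDecomposition (𝒟 : Set (Set P)) : Prop where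
  isPartition : Setoid.IsPartition 𝒟
  locallyFinite : LocallyFinite (fun M : 𝒟 => (M : Set P))
  isLocallyClosed : ∀ M ∈ 𝒟, IsLocallyClosed M
  isManifold : ∀ M ∈ 𝒟, IsSmoothManifoldVia (Subtype.val : M → P)
  frontier : FrontierCondition 𝒟

/-- A smooth stratification: a smooth decomposition into connected manifolds. -/
structure IsSmoothStratification (𝒟 : Set (Set P)) : Prop extends IsSmoothDecomposition 𝒟 where
  isConnected : ∀ M ∈ 𝒟, IsConnected M

end VectorFields

end

/-!
The orbits of all vector fields form a partition because composed flows can be composed and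
inverted, and satisfy the Frontier Condition because the closure of an orbit is invariant under
flows. The substance of the theorem is the manifold structure, an orbit theorem in the manner of
Sussmann. The argument below never pushes vector fields forward; it only uses that their flows are
smooth.

*Flows.* Near each point, `P` has a local model `Φ : P → ℝⁿ` (`exists_isLocalModel`), with
components in `C^∞(P)`, in terms of which all smooth functions are expressed. A vector field is
represented there by a compactly supported smooth vector field on `ℝⁿ`, whose flow is jointly
smooth by the implicit function theorem in the Banach space of curves (`exists_smooth_flow`). The
integral curves of a vector field follow this flow for a short time, hence are unique, and `exp tX`
has an open domain and is jointly smooth in `t` and the point, also for long times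
(`ExpRel.isSmoothFlowAt`).

*Rank.* Consider the orbit maps, which send a parameter `e` to
`(exp τ₁(e)X₁ ∘ ⋯ ∘ exp τₖ(e)Xₖ)(x₀)` with smooth `τ`. Composition with flows for fixed times
preserves their rank (`tangentKer_composedFlow`), so the maximal rank `m` is finite and is attained
by an immersion of `ℝ^m` at every point of the orbit (`exists_dimension`). By the inverse function
theorem such immersions can be parametrized so as to have left inverses in `C^∞(P)`: these are the
plaques (`exists_isPlaque`).

*Charts.* By maximality of `m`, vector fields are tangent to plaques
(`IsPlaque.derivation_apply`), so their integral curves stay in a plaque for a short time. It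
follows that composed flows that hit a plaque stay in it when the times are varied a little
(`exists_composedFlow_in_orbitMap`), so plaques are open in the manifold topology and the left
inverses are charts (`isSmoothManifoldVia_incl`). The coordinate changes are smooth, and the
inclusion is an immersion, because a chart is the restriction of functions in `C^∞(P)`.
-/

noncomputable section

/-! ### Smooth dependence of flows on time and initial values -/

/-- The Banach space of continuous curves on the unit interval. It is kept as a separate type, so
that its algebraic structure is only found through its norm. -/
def Curve (E : Type) [NormedAddCommGroup E] : Type := C(unitInterval, E)

namespace Curve

instance {E : Type} [NormedAddCommGroup E] : FunLike (Curve E) unitInterval E :=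
  inferInstanceAs (FunLike C(unitInterval, E) unitInterval E)

instance {E : Type} [NormedAddCommGroup E] : NormedAddCommGroup (Curve E) :=
  inferInstanceAs (NormedAddCommGroup C(unitInterval, E))

instance {E : Type} [NormedAddCommGroup E] [NormedSpace ℝ E] : NormedSpace ℝ (Curve E) :=
  inferInstanceAs (NormedSpace ℝ C(unitInterval, E))

instance {E : Type} [NormedAddCommGroup E] [CompleteSpace E] : CompleteSpace (Curve E) :=
  inferInstanceAs (CompleteSpace C(unitInterval, E))

/-- A continuous function on the unit interval as a curve. -/
def mk {E : Type} [NormedAddCommGroup E] (f : unitInterval → E) (hf : Continuous f) : Curve E :=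
  (⟨f, hf⟩ : C(unitInterval, E))

@[simp]
theorem mk_apply {E : Type} [NormedAddCommGroup E] (f : unitInterval → E) (hf : Continuous f)
    (t : unitInterval) : mk f hf t = f t := rfl

@[ext]
theorem ext {E : Type} [NormedAddCommGroup E] {γ δ : Curve E} (h : ∀ t, γ t = δ t) : γ = δ :=
  DFunLike.ext γ δ h

@[fun_prop]
theorem continuous {E : Type} [NormedAddCommGroup E] (γ : Curve E) : Continuous γ :=
  ContinuousMap.continuous (X := unitInterval) (Y := E) γ

section Norm

variable {E : Type} [NormedAddCommGroup E]

theorem norm_le {γ : Curve E} {C : ℝ} (hC : 0 ≤ C) : ‖γ‖ ≤ C ↔ ∀ t, ‖γ t‖ ≤ C :=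
  ContinuousMap.norm_le (α := unitInterval) (E := E) γ hC

theorem norm_coe_le_norm (γ : Curve E) (t : unitInterval) : ‖γ t‖ ≤ ‖γ‖ :=
  ContinuousMap.norm_coe_le_norm (α := unitInterval) (E := E) γ t

@[simp]
theorem zero_apply (t : unitInterval) : (0 : Curve E) t = 0 := rfl

@[simp]
theorem add_apply (γ δ : Curve E) (t : unitInterval) : (γ + δ) t = γ t + δ t := rfl

@[simp]
theorem sub_apply (γ δ : Curve E) (t : unitInterval) : (γ - δ) t = γ t - δ t := rfl

@[simp]
theorem smul_apply [NormedSpace ℝ E] (r : ℝ) (γ : Curve E) (t : unitInterval) :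
    (r • γ) t = r • γ t := rfl

end Norm

/-- The superposition operator `γ ↦ G ∘ γ` on curves. -/
def comp {E F : Type} [NormedAddCommGroup E] [NormedAddCommGroup F] (G : C(E, F))
    (γ : Curve E) : Curve F := mk (fun t => G (γ t)) (G.continuous.comp γ.continuous)

@[simp]
theorem comp_apply {E F : Type} [NormedAddCommGroup E] [NormedAddCommGroup F] (G : C(E, F))
    (γ : Curve E) (t : unitInterval) : comp G γ t = G (γ t) := rfl

variable {E F : Type} [NormedAddCommGroup E] [NormedSpace ℝ E]
  [NormedAddCommGroup F] [NormedSpace ℝ F]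

/-- The constant curves. -/
def constL : E →L[ℝ] Curve E :=
  LinearMap.mkContinuous
    { toFun := fun p => mk (fun _ => p) continuous_const
      map_add' := fun _ _ => rfl
      map_smul' := fun _ _ => rfl } 1
    (fun p => (norm_le (by positivity)).2 fun _ => (one_mul ‖p‖).ge)

@[simp]
theorem constL_apply (p : E) (t : unitInterval) : constL p t = p := rfl

/-- Pointwise application of a curve of operators to a curve. -/
def applyL : Curve (E →L[ℝ] F) →L[ℝ] Curve E →L[ℝ] Curve F :=
  LinearMap.mkContinuous₂
    (LinearMap.mk₂ ℝ (fun (A : Curve (E →L[ℝ] F)) (γ : Curve E) =>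
      mk (fun t => A t (γ t)) (by fun_prop))
      (fun _ _ _ => by ext; simp) (fun _ _ _ => by ext; simp)
      (fun _ _ _ => by ext; simp) (fun _ _ _ => by ext; simp)) 1
    (fun A γ => by
      refine (norm_le (by positivity)).2 fun t => ?_
      rw [one_mul]
      exact (A t).le_of_opNorm_le_of_le (A.norm_coe_le_norm t) (γ.norm_coe_le_norm t))

/-- The superposition operator of a compactly supported `G` is differentiable, because `fderiv ℝ G`
is uniformly continuous. -/
theorem hasFDerivAt_comp (G : C(E, F)) (hG : ContDiff ℝ 1 G) (hc : HasCompactSupport G)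
    (γ : Curve E) :
    HasFDerivAt (comp G)
      (applyL (comp ⟨fderiv ℝ G, hG.continuous_fderiv one_ne_zero⟩ γ)) γ := by
  have huc : UniformContinuous (fderiv ℝ G) :=
    (hc.fderiv ℝ).uniformContinuous_of_continuous (hG.continuous_fderiv one_ne_zero)
  rw [hasFDerivAt_iff_isLittleO_nhds_zero, Asymptotics.isLittleO_iff]
  intro ε hε
  obtain ⟨δ, hδ, hd⟩ := Metric.uniformContinuous_iff.1 huc ε hε
  filter_upwards [Metric.ball_mem_nhds (0 : Curve E) hδ] with η hη
  rw [norm_le (by positivity)]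
  intro t
  have hηt : ‖η t‖ ≤ ‖η‖ := η.norm_coe_le_norm t
  have key := (convex_segment (γ t) (γ t + η t)).norm_image_sub_le_of_norm_fderiv_le' (𝕜 := ℝ)
    (f := G) (C := ε) (φ := fderiv ℝ G (γ t)) (x := γ t) (y := γ t + η t)
    (fun x _ => (hG.differentiable one_ne_zero) x)
    (fun x hx => by
      rw [← dist_eq_norm]
      refine (hd ?_).le
      obtain ⟨a, b, ha, hb, hab, rfl⟩ := hx
      have h1 : a • γ t + b • (γ t + η t) - γ t = b • η t := by
        rw [smul_add, ← add_assoc, ← add_smul, hab, one_smul]; abel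
      rw [dist_eq_norm, h1, norm_smul, Real.norm_of_nonneg hb]
      have hη' : ‖η‖ < δ := by simpa using hη
      nlinarith [norm_nonneg (η t)])
    (left_mem_segment ℝ _ _) (right_mem_segment ℝ _ _)
  simp only [add_sub_cancel_left] at key
  exact key.trans (mul_le_mul_of_nonneg_left hηt hε.le)

theorem contDiff_comp_nat (n : ℕ) : ∀ {F : Type} [NormedAddCommGroup F] [NormedSpace ℝ F]
    (G : C(E, F)), ContDiff ℝ ∞ G → HasCompactSupport G → ContDiff ℝ n (comp G) := by
  induction n with
  | zero =>
    intro F _ _ G hG hc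
    have h : Differentiable ℝ (comp G) := fun γ =>
      (hasFDerivAt_comp G (hG.of_le (by simp)) hc γ).differentiableAt
    exact contDiff_zero.2 h.continuous
  | succ n ih =>
    intro F _ _ G hG hc
    have h1 : ContDiff ℝ 1 G := hG.of_le (by simp)
    rw [Nat.cast_add, Nat.cast_one, contDiff_succ_iff_hasFDerivAt]
    exact ⟨fun γ => applyL (comp ⟨fderiv ℝ G, h1.continuous_fderiv one_ne_zero⟩ γ),
      (applyL (E := E) (F := F)).contDiff.comp (ih ⟨fderiv ℝ G, h1.continuous_fderiv one_ne_zero⟩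
        (hG.fderiv_right (by simp)) (hc.fderiv ℝ)), fun γ => hasFDerivAt_comp G h1 hc γ⟩

theorem contDiff_comp (G : C(E, F)) (hG : ContDiff ℝ ∞ G) (hc : HasCompactSupport G) :
    ContDiff ℝ ∞ (comp G) :=
  contDiff_infty.2 fun n => contDiff_comp_nat n G hG hc

/-- The primitive vanishing at `0` of a curve on the unit interval, as a linear map. -/
def primLinear : Curve E →ₗ[ℝ] Curve E :=
  have hcont : ∀ γ : Curve E,
      Continuous fun τ : ℝ => γ (projIcc (0 : ℝ) 1 zero_le_one τ) :=
    fun γ => γ.continuous.comp continuous_projIcc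
  { toFun := fun γ => mk (fun t => ∫ τ in (0 : ℝ)..t, γ (projIcc (0 : ℝ) 1 zero_le_one τ))
      ((intervalIntegral.continuous_primitive (fun a b => (hcont γ).intervalIntegrable a b) 0).comp
        continuous_subtype_val)
    map_add' := fun γ δ => by
      ext t
      exact intervalIntegral.integral_add ((hcont γ).intervalIntegrable _ _)
        ((hcont δ).intervalIntegrable _ _)
    map_smul' := fun r γ => by
      ext t
      exact intervalIntegral.integral_smul r _ }

theorem norm_primLinear_le (γ : Curve E) : ‖primLinear γ‖ ≤ 1 * ‖γ‖ := by
  refine (norm_le (by positivity)).2 fun t => ?_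
  have h := intervalIntegral.norm_integral_le_of_norm_le_const (a := (0 : ℝ)) (b := t)
    (C := ‖γ‖) (f := fun τ => γ (projIcc (0 : ℝ) 1 zero_le_one τ))
    (fun τ _ => γ.norm_coe_le_norm _)
  refine h.trans ?_
  have h1 : |(t : ℝ) - 0| ≤ 1 := by
    rw [sub_zero, abs_of_nonneg t.2.1]; exact t.2.2
  rw [one_mul]
  exact mul_le_of_le_one_right (norm_nonneg _) h1

/-- The primitive vanishing at `0` of a curve on the unit interval, as a bounded operator. -/
def primL : Curve E →L[ℝ] Curve E :=
  primLinear.mkContinuous 1 norm_primLinear_le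

theorem primL_apply (γ : Curve E) (t : unitInterval) :
    primL γ t = ∫ τ in (0 : ℝ)..t, γ (projIcc (0 : ℝ) 1 zero_le_one τ) := rfl

theorem norm_primL_le : ‖(primL : Curve E →L[ℝ] Curve E)‖ ≤ 1 :=
  LinearMap.mkContinuous_norm_le _ zero_le_one _

/-- The defect of a curve `γ` as a solution of the integral equation
`γ(r) = p + s ∫₀ʳ G(γ)`, whose solutions are the integral curves of `G` starting at `p`,
followed for the time `s` and rescaled to the unit interval. -/
def flowDefect (G : C(E, E)) (z : (ℝ × E) × Curve E) : Curve E :=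
  z.2 - constL z.1.2 - z.1.1 • primL (comp G z.2)

theorem contDiff_flowDefect (G : C(E, E)) (hG : ContDiff ℝ ∞ G) (hc : HasCompactSupport G) :
    ContDiff ℝ ∞ (flowDefect G) := by
  have h1 : ContDiff ℝ ∞ fun p : E => constL p := constL.contDiff
  have h2 := contDiff_comp G hG hc
  have h3 : ContDiff ℝ ∞ fun γ : Curve E => primL γ := primL.contDiff
  exact (contDiff_snd.sub (h1.comp (contDiff_snd.comp contDiff_fst))).sub
    ((contDiff_fst.comp contDiff_fst).smul (h3.comp (h2.comp contDiff_snd)))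

/-- For times that are short compared to the Lipschitz constant, the partial derivative of the
defect in the direction of curves is a small perturbation of the identity. -/
theorem isInvertible_flowDefect (G : C(E, E)) [CompleteSpace E] (hG : ContDiff ℝ ∞ G)
    (hc : HasCompactSupport G) {K : NNReal} (hK : LipschitzWith K G) {s : ℝ} (hs : |s| * K < 1)
    (p : E) (γ : Curve E) :
    (fderiv ℝ (flowDefect G) ((s, p), γ) ∘L
      ContinuousLinearMap.inr ℝ (ℝ × E) (Curve E)).IsInvertible := by
  have h1 : ContDiff ℝ 1 G := hG.of_le (by simp)
  set A : Curve E →L[ℝ] Curve E :=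
    applyL (comp ⟨fderiv ℝ G, h1.continuous_fderiv one_ne_zero⟩ γ) with hA
  have hAn : ‖A‖ ≤ K := by
    refine ContinuousLinearMap.opNorm_le_bound _ K.2 fun η => ?_
    refine (norm_le (by positivity)).2 fun t => ?_
    exact ContinuousLinearMap.le_of_opNorm_le_of_le _ (norm_fderiv_le_of_lipschitz ℝ hK)
      (η.norm_coe_le_norm t)
  have hd : HasFDerivAt (fun δ => flowDefect G ((s, p), δ)) (1 - s • (primL ∘L A)) γ := by
    have e1 : HasFDerivAt (fun δ : Curve E => primL (comp G δ))
        (primL ∘L A) γ :=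
      primL.hasFDerivAt.comp γ (hasFDerivAt_comp G h1 hc γ)
    exact (((hasFDerivAt_id γ).sub_const (constL p)).sub
      (e1.const_smul s)).congr_of_eventuallyEq (Eventually.of_forall fun δ => rfl)
  have hd' : HasFDerivAt (fun δ => flowDefect G ((s, p), δ))
      (fderiv ℝ (flowDefect G) ((s, p), γ) ∘L
        ContinuousLinearMap.inr ℝ (ℝ × E) (Curve E)) γ :=
    (((contDiff_flowDefect G hG hc).differentiable (by simp)) _).hasFDerivAt.comp γ
      (hasFDerivAt_prodMk_right (s, p) γ)
  rw [hd'.unique hd]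
  have hn : ‖s • (primL ∘L A)‖ < 1 := by
    rw [norm_smul, Real.norm_eq_abs]
    refine lt_of_le_of_lt ?_ hs
    refine mul_le_mul_of_nonneg_left ?_ (abs_nonneg s)
    refine (ContinuousLinearMap.opNorm_comp_le _ _).trans ?_
    calc _ ≤ 1 * (K : ℝ) := mul_le_mul norm_primL_le hAn (norm_nonneg _) zero_le_one
      _ = K := one_mul _
  obtain ⟨u, hu⟩ := isUnit_one_sub_of_norm_lt_one hn
  rw [← hu]
  exact ⟨ContinuousLinearEquiv.unitsEquiv ℝ _ u, rfl⟩

theorem eq_of_flowDefect_eq_zero (G : C(E, E)) {K : NNReal} (hK : LipschitzWith K G) {s : ℝ}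
    (hs : |s| * K < 1) {p : E} {γ δ : Curve E} (hγ : flowDefect G ((s, p), γ) = 0)
    (hδ : flowDefect G ((s, p), δ) = 0) : γ = δ := by
  have h1 : γ - δ = s • primL (comp G γ - comp G δ) := by
    rw [map_sub, smul_sub]
    simp only [flowDefect] at hγ hδ
    rw [sub_sub, sub_eq_zero] at hγ hδ
    conv_lhs => rw [hγ, hδ]
    abel
  have h2 : ‖comp G γ - comp G δ‖ ≤ K * ‖γ - δ‖ := by
    refine (norm_le (by positivity)).2 fun t => ?_
    exact (hK.norm_sub_le _ _).trans
      (mul_le_mul_of_nonneg_left ((γ - δ).norm_coe_le_norm t) K.2)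
  have h3 : ‖γ - δ‖ ≤ |s| * K * ‖γ - δ‖ := by
    calc ‖γ - δ‖ = |s| * ‖primL (comp G γ - comp G δ)‖ := by
          conv_lhs => rw [h1, norm_smul, Real.norm_eq_abs]
      _ ≤ |s| * (1 * (K * ‖γ - δ‖)) := by
          refine mul_le_mul_of_nonneg_left ?_ (abs_nonneg s)
          exact (norm_primLinear_le _).trans (by linarith)
      _ = |s| * K * ‖γ - δ‖ := by ring
  have h4 : ‖γ - δ‖ ≤ 0 := by nlinarith [norm_nonneg (γ - δ)]
  exact sub_eq_zero.1 (norm_le_zero_iff.1 h4)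

theorem exists_flowDefect_eq_zero [CompleteSpace E] (G : C(E, E)) {K : NNReal}
    (hK : LipschitzWith K G) {s : ℝ} (hs : |s| * K < 1) (p : E) :
    ∃ γ, flowDefect G ((s, p), γ) = 0 := by
  let T : Curve E → Curve E := fun γ =>
    constL p + s • primL (comp G γ)
  have hT : ContractingWith ⟨|s| * K, by positivity⟩ T := by
    refine ⟨by exact_mod_cast hs, LipschitzWith.of_dist_le_mul fun γ δ => ?_⟩
    have h2 : ‖comp G γ - comp G δ‖ ≤ K * ‖γ - δ‖ := by
      refine (norm_le (by positivity)).2 fun t => ?_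
      exact (hK.norm_sub_le _ _).trans
        (mul_le_mul_of_nonneg_left ((γ - δ).norm_coe_le_norm t) K.2)
    have h1 : T γ - T δ = s • primL (comp G γ - comp G δ) := by
      rw [map_sub, smul_sub]
      simp only [T]
      abel
    rw [dist_eq_norm, dist_eq_norm, h1, norm_smul, Real.norm_eq_abs]
    calc _ ≤ |s| * (1 * (K * ‖γ - δ‖)) := by
          refine mul_le_mul_of_nonneg_left ?_ (abs_nonneg s)
          exact (norm_primLinear_le _).trans (by linarith)
      _ = |s| * K * ‖γ - δ‖ := by ring
  refine ⟨hT.fixedPoint, ?_⟩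
  have h := hT.fixedPoint_isFixedPt
  have h' : T hT.fixedPoint = hT.fixedPoint := h
  simp only [flowDefect]
  rw [sub_sub, sub_eq_zero]
  exact h'.symm

/-- A curve on the unit interval that solves the rescaled differential equation solves the
integral equation. -/
theorem flowDefect_eq_zero_of_hasDerivWithinAt [CompleteSpace E] {G : C(E, E)} {s : ℝ} {p : E}
    {γ : ℝ → E} (h0 : γ 0 = p) (hcont : Continuous fun t : unitInterval => γ t)
    (hγ : ∀ r ∈ Icc (0 : ℝ) 1, HasDerivWithinAt γ (s • G (γ r)) (Icc 0 1) r) :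
    flowDefect G ((s, p), mk (fun t => γ t) hcont) = 0 := by
  have hcont' : ContinuousOn γ (Icc 0 1) := fun r hr => (hγ r hr).continuousWithinAt
  ext t
  simp only [flowDefect, sub_apply, smul_apply, mk_apply, constL_apply, zero_apply, primL_apply,
    comp_apply]
  have hsub : Icc (0 : ℝ) t ⊆ Icc 0 1 := Icc_subset_Icc_right t.2.2
  have hci : Continuous fun τ : ℝ => G (γ (projIcc (0 : ℝ) 1 zero_le_one τ)) :=
    G.continuous.comp (hcont.comp continuous_projIcc)
  have key : ∫ τ in (0 : ℝ)..t, s • G (γ (projIcc (0 : ℝ) 1 zero_le_one τ)) = γ t - γ 0 := by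
    refine intervalIntegral.integral_eq_sub_of_hasDerivAt_of_le t.2.1 (hcont'.mono hsub)
      (fun x hx => ?_) ((hci.const_smul s).intervalIntegrable _ _)
    have hx1 : x ∈ Icc (0 : ℝ) 1 := ⟨hx.1.le, hx.2.le.trans t.2.2⟩
    rw [projIcc_of_mem _ hx1]
    exact (hγ x hx1).hasDerivAt (Icc_mem_nhds hx.1 (hx.2.trans_le t.2.2))
  rw [intervalIntegral.integral_smul] at key
  rw [key, h0]
  abel

/-- A solution of the integral equation extends to a differentiable curve on the line which solves
the rescaled differential equation on the unit interval. -/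
theorem exists_hasDerivWithinAt_of_flowDefect_eq_zero [CompleteSpace E] {G : C(E, E)} {s : ℝ}
    {p : E} {γ : Curve E} (h : flowDefect G ((s, p), γ) = 0) :
    ∃ c : ℝ → E, c 0 = p ∧ (∀ t : unitInterval, c t = γ t) ∧
      ∀ r ∈ Icc (0 : ℝ) 1, HasDerivWithinAt c (s • G (c r)) (Icc 0 1) r := by
  have hci : Continuous fun τ : ℝ => G (γ (projIcc (0 : ℝ) 1 zero_le_one τ)) :=
    G.continuous.comp (γ.continuous.comp continuous_projIcc)
  have hc : ∀ t : unitInterval,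
      p + s • ∫ τ in (0 : ℝ)..t, G (γ (projIcc (0 : ℝ) 1 zero_le_one τ)) = γ t := by
    intro t
    have ht := congrArg (fun δ : Curve E => δ t) h
    simp only [flowDefect, sub_apply, smul_apply, constL_apply, zero_apply, primL_apply,
      comp_apply] at ht
    rw [sub_sub, sub_eq_zero] at ht
    exact ht.symm
  refine ⟨fun r => p + s • ∫ τ in (0 : ℝ)..r, G (γ (projIcc (0 : ℝ) 1 zero_le_one τ)),
    by simp, hc, fun r hr => ?_⟩
  have h1 := (intervalIntegral.integral_hasDerivAt_right (hci.intervalIntegrable 0 r)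
    (hci.stronglyMeasurableAtFilter _ _) hci.continuousAt).const_smul s
  rw [projIcc_of_mem _ hr, ← hc ⟨r, hr⟩] at h1
  exact (h1.const_add p).hasDerivWithinAt

end Curve

/-- The germ of a smooth map extends to a smooth map with compact support. -/
theorem exists_contDiff_hasCompactSupport_eventuallyEq {E F : Type*} [NormedAddCommGroup E]
    [NormedSpace ℝ E] [FiniteDimensional ℝ E] [NormedAddCommGroup F] [NormedSpace ℝ F]
    {k : E → F} {B : Set E} (hB : IsOpen B) (hk : ∀ u ∈ B, ContDiffAt ℝ ∞ k u) {u₀ : E}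
    (hu₀ : u₀ ∈ B) : ∃ K : E → F, ContDiff ℝ ∞ K ∧ HasCompactSupport K ∧ K =ᶠ[𝓝 u₀] k := by
  obtain ⟨ρ, hρ, hρB⟩ := Metric.isOpen_iff.1 hB u₀ hu₀
  let χ : ContDiffBump u₀ := ⟨ρ / 4, ρ / 2, by positivity, by linarith⟩
  refine ⟨fun u => χ u • k u, contDiff_iff_contDiffAt.2 fun u => ?_,
    χ.hasCompactSupport.smul_right, ?_⟩
  · by_cases hu : u ∈ B
    · exact χ.contDiffAt.smul (hk u hu)
    · have h2 : u ∈ (Metric.closedBall u₀ (ρ / 2))ᶜ := fun h3 =>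
        hu (hρB (Metric.closedBall_subset_ball (by linarith) h3))
      have h1 : (fun u => χ u • k u) =ᶠ[𝓝 u] fun _ => 0 := by
        filter_upwards [Metric.isClosed_closedBall.isOpen_compl.mem_nhds h2] with v hv
        have h3 : χ v = 0 := χ.zero_of_le_dist (by
          rw [mem_compl_iff, Metric.mem_closedBall, not_le] at hv
          exact hv.le)
        rw [h3, zero_smul]
      exact contDiffAt_const.congr_of_eventuallyEq h1
  · filter_upwards [χ.eventuallyEq_one] with u hu
    rw [hu, Pi.one_apply, one_smul]

/-- **Smooth dependence on initial values.** A smooth compactly supported vector field on a Banach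
space has a local flow, defined everywhere for short times, which is jointly smooth in time and
initial value. -/
theorem exists_smooth_flow {E : Type} [NormedAddCommGroup E] [NormedSpace ℝ E] [CompleteSpace E]
    {G : E → E} (hG : ContDiff ℝ ∞ G) (hc : HasCompactSupport G) :
    ∃ ε > 0, ∃ Θ : ℝ × E → E, (∀ s p, |s| < ε → ContDiffAt ℝ ∞ Θ (s, p)) ∧
      (∀ s p, |s| < ε → ∃ c : ℝ → E, c 0 = p ∧ c s = Θ (s, p) ∧
        ∀ r ∈ uIcc 0 s, HasDerivWithinAt c (G (c r)) (uIcc 0 s) r) ∧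
      (∀ s p, |s| < ε → ∀ c : ℝ → E, c 0 = p →
        (∀ r ∈ uIcc 0 s, HasDerivWithinAt c (G (c r)) (uIcc 0 s) r) → c s = Θ (s, p)) := by
  obtain ⟨K, hK⟩ := hG.lipschitzWith_of_hasCompactSupport hc (by simp)
  let G' : C(E, E) := ⟨G, hG.continuous⟩
  have hK1 : (0 : ℝ) < K + 1 := by positivity
  have hsK : ∀ s : ℝ, |s| < 1 / (K + 1) → |s| * K < 1 := by
    intro s hs
    rw [lt_div_iff₀ hK1] at hs
    nlinarith [abs_nonneg s]
  have hex : ∀ z : ℝ × E, ∃ γ, |z.1| < 1 / (K + 1) → Curve.flowDefect G' (z, γ) = 0 := by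
    intro z
    by_cases hz : |z.1| < 1 / ((K : ℝ) + 1)
    · obtain ⟨γ, hγ⟩ := Curve.exists_flowDefect_eq_zero G' hK (hsK _ hz) z.2
      exact ⟨γ, fun _ => hγ⟩
    · exact ⟨0, fun h => absurd h hz⟩
  choose Γ hΓ using hex
  refine ⟨1 / (K + 1), by positivity, fun z => Γ z 1, ?_, ?_, ?_⟩
  -- By uniqueness the solutions agree with the implicit function near each point.
  · intro s p hs
    have cdf : ContDiffAt ℝ ∞ (Curve.flowDefect G') ((s, p), Γ (s, p)) :=
      (Curve.contDiff_flowDefect G' hG hc).contDiffAt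
    have hinv := Curve.isInvertible_flowDefect G' hG hc hK (hsK s hs) p (Γ (s, p))
    have hsm := cdf.contDiffAt_implicitFunction (by simp) hinv
    have hev := cdf.eventually_apply_implicitFunction (by simp) hinv
    have hnear : ∀ᶠ z : ℝ × E in 𝓝 (s, p), |z.1| < 1 / ((K : ℝ) + 1) :=
      (continuous_abs.comp continuous_fst).continuousAt.eventually_lt continuousAt_const hs
    have heq : Γ =ᶠ[𝓝 (s, p)] cdf.implicitFunction (by simp) hinv := by
      filter_upwards [hev, hnear] with z hz1 hz2
      rw [hΓ (s, p) hs] at hz1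
      exact Curve.eq_of_flowDefect_eq_zero G' hK (hsK _ hz2) (hΓ z hz2) hz1
    let ev : Curve E →L[ℝ] E := LinearMap.mkContinuous
      { toFun := fun γ => γ 1, map_add' := fun _ _ => rfl, map_smul' := fun _ _ => rfl } 1
      (fun γ => by rw [one_mul]; exact γ.norm_coe_le_norm 1)
    exact ev.contDiff.contDiffAt.comp (s, p) (hsm.congr_of_eventuallyEq heq)
  · intro s p hs
    obtain ⟨c, hc0, hc1, hcd⟩ := Curve.exists_hasDerivWithinAt_of_flowDefect_eq_zero (hΓ (s, p) hs)
    rcases eq_or_ne s 0 with rfl | hs0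
    · refine ⟨fun _ => p, rfl, ?_, fun r hr => ?_⟩
      · have h1 := congrArg (fun δ : Curve E => δ 1) (hΓ (0, p) hs)
        simp only [Curve.flowDefect, Curve.sub_apply, Curve.constL_apply,
          Curve.zero_apply, zero_smul, sub_zero] at h1
        exact (sub_eq_zero.1 h1).symm
      · rw [uIcc_self] at hr ⊢
        rw [mem_singleton_iff.1 hr]
        exact HasFDerivWithinAt.of_subsingleton subsingleton_singleton
    · refine ⟨fun r => c (r / s), by simpa using hc0, ?_, fun r hr => ?_⟩
      · simpa [hs0] using hc1 1
      · have hm : MapsTo (fun r : ℝ => r / s) (uIcc 0 s) (Icc 0 1) := by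
          intro r hr
          rcases lt_or_gt_of_ne hs0 with h | h
          · rw [uIcc_of_ge h.le] at hr
            exact ⟨div_nonneg_of_nonpos hr.2 h.le, (div_le_one_of_neg h).2 hr.1⟩
          · rw [uIcc_of_le h.le] at hr
            exact ⟨div_nonneg hr.1 h.le, (div_le_one h).2 hr.2⟩
        have h1 := (hcd (r / s) (hm hr)).scomp r
          ((hasDerivWithinAt_id r (uIcc 0 s)).div_const s) hm
        rw [smul_smul, one_div, inv_mul_cancel₀ hs0, one_smul] at h1
        exact h1
  · intro s p hs c hc0 hcd
    have hm : MapsTo (fun r : ℝ => r * s) (Icc 0 1) (uIcc 0 s) := by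
      intro r hr
      rcases le_total 0 s with h | h
      · rw [uIcc_of_le h]
        exact ⟨mul_nonneg hr.1 h, mul_le_of_le_one_left h hr.2⟩
      · rw [uIcc_of_ge h]
        exact ⟨by nlinarith [hr.1, hr.2], mul_nonpos_of_nonneg_of_nonpos hr.1 h⟩
    have hd : ∀ r ∈ Icc (0 : ℝ) 1,
        HasDerivWithinAt (fun r => c (r * s)) (s • G' (c (r * s))) (Icc 0 1) r := by
      intro r hr
      have h1 := (hcd (r * s) (hm hr)).scomp r
        ((hasDerivWithinAt_id r (Icc 0 1)).mul_const s) hm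
      rw [one_mul] at h1
      exact h1
    have hz := Curve.flowDefect_eq_zero_of_hasDerivWithinAt (p := p) (by simpa using hc0)
      (continuousOn_iff_continuous_domRestrict.1 fun r hr => (hd r hr).continuousWithinAt) hd
    have h2 := Curve.eq_of_flowDefect_eq_zero G' hK (hsK s hs) hz (hΓ (s, p) hs)
    have h3 : c (((1 : unitInterval) : ℝ) * s) = Γ (s, p) 1 :=
      congrArg (fun δ : Curve E => δ 1) h2
    rwa [Icc.coe_one, one_mul] at h3

/-! ### Local models of subcartesian spaces -/

section LocalModel

variable {P : Type*} [TopologicalSpace P] [DifferentialSpace P]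

theorem SmoothFn.comp_contDiff {n : ℕ} {Φ : P → Fin n → ℝ}
    (hΦ : ∀ i, (fun y => Φ y i) ∈ SmoothFn P) {F : (Fin n → ℝ) → ℝ} (hF : ContDiff ℝ ∞ F) :
    (fun y => F (Φ y)) ∈ SmoothFn P :=
  DifferentialSpace.comp_mem n (fun i y => Φ y i) F hΦ hF

theorem SmoothFn.comp_contDiff_real {f : P → ℝ} (hf : f ∈ SmoothFn P) {F : ℝ → ℝ}
    (hF : ContDiff ℝ ∞ F) : (fun y => F (f y)) ∈ SmoothFn P :=
  DifferentialSpace.comp_mem 1 (fun _ => f) (fun z => F (z 0)) (fun _ => hf)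
    (hF.comp (contDiff_apply ℝ ℝ 0))

/-- Smooth bump functions exist on every differential space, since its topology is generated by
smooth functions. -/
theorem SmoothFn.exists_bump {x : P} {W : Set P} (hW : W ∈ 𝓝 x) :
    ∃ β ∈ SmoothFn P, (∀ᶠ y in 𝓝 x, β y = 1) ∧ ∀ y, β y ≠ 0 → y ∈ W := by
  -- The neighbourhoods with the required property form a filter, so it is enough to consider a
  -- subbasis of the topology.
  let ℱ : Filter P :=
    { sets := {W | ∃ β ∈ SmoothFn P, (∀ᶠ y in 𝓝 x, β y = 1) ∧ ∀ y, β y ≠ 0 → y ∈ W}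
      univ_sets := ⟨1, one_mem _, Eventually.of_forall fun _ => rfl, fun _ _ => mem_univ _⟩
      sets_of_superset := by
        rintro A B ⟨β, h1, h2, h3⟩ hAB
        exact ⟨β, h1, h2, fun y hy => hAB (h3 y hy)⟩
      inter_sets := by
        rintro A B ⟨β, h1, h2, h3⟩ ⟨β', h1', h2', h3'⟩
        refine ⟨β * β', mul_mem h1 h1', ?_, fun y hy => ?_⟩
        · filter_upwards [h2, h2'] with y hy hy'
          simp [hy, hy']
        · have := mul_ne_zero_iff.1 hy
          exact ⟨h3 y this.1, h3' y this.2⟩ }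
  suffices h : ℱ ≤ 𝓝 x from h hW
  have hgen := TopologicalSpace.nhds_generateFrom
    (g := {V : Set P | ∃ f ∈ SmoothFn P, ∃ a b : ℝ, V = f ⁻¹' Ioo a b}) (a := x)
  rw [← DifferentialSpace.generate (P := P)] at hgen
  rw [hgen]
  refine le_iInf₂ fun V hV => le_principal_iff.2 ?_
  obtain ⟨hx, f, hf, a, b, rfl⟩ := hV
  obtain ⟨r, hr, hball⟩ := Metric.isOpen_iff.1 isOpen_Ioo (f x) hx
  let b : ContDiffBump (f x) := ⟨r / 4, r / 2, by positivity, by linarith⟩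
  refine ⟨fun y => b (f y), SmoothFn.comp_contDiff_real hf b.contDiff, ?_, fun y hy => hball ?_⟩
  · exact (SmoothFn.continuous hf).continuousAt.eventually b.eventuallyEq_one
  · have h1 : f y ∈ Function.support b := hy
    rw [b.support_eq, Metric.mem_ball] at h1
    have h2 : b.rOut = r / 2 := rfl
    rw [Metric.mem_ball]
    linarith

/-- `Φ` is a local model of `P` on the open set `U`: its components are smooth functions on all of
`P`, it induces the topology of `P` at the points of `U`, and every smooth function on `P` is,
near each point of `U`, a smooth function of `Φ`. -/
structure IsLocalModel {n : ℕ} (Φ : P → Fin n → ℝ) (U : Set P) : Prop where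
  isOpen : IsOpen U
  smooth : ∀ i, (fun y => Φ y i) ∈ SmoothFn P
  nhds_eq : ∀ u ∈ U, 𝓝 u = comap Φ (𝓝 (Φ u))
  extend : ∀ u ∈ U, ∀ f ∈ SmoothFn P,
    ∃ F : (Fin n → ℝ) → ℝ, ContDiff ℝ ∞ F ∧ ∀ᶠ y in 𝓝 u, f y = F (Φ y)

theorem IsLocalModel.continuous {n : ℕ} {Φ : P → Fin n → ℝ} {U : Set P} (h : IsLocalModel Φ U) :
    Continuous Φ :=
  continuous_pi fun i => SmoothFn.continuous (h.smooth i)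

/-- A local model separates the points of `U` from all points of `P`, inside and outside `U`. -/
theorem IsLocalModel.eq_of_eq [T2Space P] {n : ℕ} {Φ : P → Fin n → ℝ} {U : Set P}
    (h : IsLocalModel Φ U) {u w : P} (hu : u ∈ U) (hw : Φ w = Φ u) : w = u := by
  rw [← pure_le_nhds_iff, h.nhds_eq u hu, ← map_le_iff_le_comap, map_pure, hw]
  exact pure_le_nhds _

/-- A local model around `x` is `(β, β g₁, …, β g_N)` for functions `gᵢ` which near `x` are the
coordinates of an embedding in `ℝ^N`, and a bump function `β`. The first component makes sure that
`Φ` separates points near `x` from all points far away. -/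
theorem exists_isLocalModel (hP : IsSubcartesian P) (x : P) :
    ∃ (n : ℕ) (Φ : P → Fin n → ℝ) (U : Set P), x ∈ U ∧ IsLocalModel Φ U := by
  obtain ⟨A, hA, N, S, ⟨φ⟩⟩ := hP.2 x
  let e := φ.toHomeomorph
  have hxA : x ∈ A := mem_of_mem_nhds hA
  have hcoord : ∀ i : Fin N, (fun s : S => (s : EuclideanSpace ℝ (Fin N)) i) ∈ SmoothFn S := by
    intro i s
    refine ⟨fun z => z i, mem_euclideanSmoothFn.2 ?_, Eventually.of_forall fun _ => rfl⟩
    fun_prop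
  have hg : ∀ i : Fin N, ∃ g ∈ SmoothFn P,
      ∀ᶠ y in 𝓝 x, ∀ hy : y ∈ A, (e ⟨y, hy⟩ : EuclideanSpace ℝ (Fin N)) i = g y := by
    intro i
    obtain ⟨g, hg, hgx⟩ := φ.smooth_toFun _ (hcoord i) ⟨x, hxA⟩
    refine ⟨g, hg, ?_⟩
    rw [nhds_subtype_eq_comap, eventually_comap] at hgx
    filter_upwards [hgx] with y hy hyA
    exact hy ⟨y, hyA⟩ rfl
  choose g hgs hg using hg
  obtain ⟨W, hW, hWo, hxW⟩ := mem_nhds_iff.1 ((eventually_all.2 hg).and hA)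
  have hWA : W ⊆ A := fun y hy => (hW hy).2
  obtain ⟨β, hβ, hβ1, hβW⟩ := SmoothFn.exists_bump (hWo.mem_nhds hxW)
  have hval : ∀ y (hy : y ∈ W),
      (e ⟨y, hWA hy⟩ : EuclideanSpace ℝ (Fin N)) = WithLp.toLp 2 fun i => g i y := by
    intro y hy
    ext i
    exact (hW hy).1 i (hWA hy)
  have hU : ∀ u ∈ interior {y | β y = 1}, ∀ᶠ y in 𝓝 u, β y = 1 ∧ y ∈ W := by
    intro u hu
    filter_upwards [isOpen_interior.mem_nhds hu] with y hy
    have h1 : y ∈ {y | β y = 1} := interior_subset hy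
    exact ⟨h1, hβW y (by rw [h1.out]; exact one_ne_zero)⟩
  have hΦ : ∀ i, (fun y => (Fin.cons (β y) (fun j => β y * g j y) : Fin (N + 1) → ℝ) i) ∈
      SmoothFn P := by
    intro i
    refine Fin.cases ?_ (fun j => ?_) i
    · exact hβ
    · exact mul_mem hβ (hgs j)
  refine ⟨N + 1, fun y => Fin.cons (β y) fun i => β y * g i y, interior {y | β y = 1},
    mem_interior_iff_mem_nhds.2 hβ1, isOpen_interior, hΦ, fun u hu => ?_, fun u hu f hf => ?_⟩
  · obtain ⟨hu1, huW⟩ := (hU u hu).self_of_nhds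
    refine le_antisymm ?_ fun V hV => ?_
    · exact ((continuous_pi fun i => SmoothFn.continuous (hΦ i)).tendsto u).le_comap
    · have h1 : ∀ᶠ s : S in 𝓝 (e ⟨u, hWA huW⟩), (e.symm s : P) ∈ V := by
        have h2 : Tendsto (fun s : S => (e.symm s : P)) (𝓝 (e ⟨u, hWA huW⟩)) (𝓝 u) := by
          have := (continuous_subtype_val.comp e.symm.continuous).tendsto (e ⟨u, hWA huW⟩)
          simpa [Function.comp_def] using this
        exact h2 hV
      rw [nhds_subtype_eq_comap, eventually_comap, hval u huW] at h1
      have h3 : Tendsto (fun z : Fin (N + 1) → ℝ =>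
          (WithLp.toLp 2 fun i : Fin N => z i.succ / z 0 : EuclideanSpace ℝ (Fin N)))
          (𝓝 (Fin.cons (β u) fun i => β u * g i u)) (𝓝 (WithLp.toLp 2 fun i => g i u)) := by
        have h4 : ContinuousAt (fun z : Fin (N + 1) → ℝ =>
            (WithLp.toLp 2 fun i : Fin N => z i.succ / z 0 : EuclideanSpace ℝ (Fin N)))
            (Fin.cons (β u) fun i => β u * g i u) := by
          refine (PiLp.continuous_toLp 2 fun _ : Fin N => ℝ).continuousAt.comp
            (continuousAt_pi.2 fun i => ?_)
          refine (continuous_apply i.succ).continuousAt.div (continuous_apply 0).continuousAt ?_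
          simp [hu1]
        have h5 := h4.tendsto
        simpa [hu1] using h5
      have h6 : ∀ᶠ z : Fin (N + 1) → ℝ in 𝓝 (Fin.cons (β u) fun i => β u * g i u), z 0 ≠ 0 := by
        refine (continuous_apply 0).continuousAt.eventually_ne ?_
        simp [hu1]
      refine ⟨_, (h3.eventually h1).and h6, fun y hy => ?_⟩
      obtain ⟨hy1, hy2⟩ := hy
      have hβy : β y ≠ 0 := by simpa using hy2
      have hyW : y ∈ W := hβW y hβy
      have := hy1 (e ⟨y, hWA hyW⟩) (by
        rw [hval y hyW]
        ext i
        simp [hβy])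
      simpa using this
  · obtain ⟨hu1, huW⟩ := (hU u hu).self_of_nhds
    have hfA : (fun y : A => f y) ∈ SmoothFn A :=
      fun _ => ⟨f, hf, Eventually.of_forall fun _ => rfl⟩
    obtain ⟨G, hG, hGe⟩ := φ.smooth_invFun _ hfA (e ⟨u, hWA huW⟩)
    refine ⟨fun z => G (WithLp.toLp 2 fun i => z i.succ), ?_, ?_⟩
    · exact (mem_euclideanSmoothFn.1 hG).comp ((PiLp.contDiff_toLp).comp
        (contDiff_pi.2 fun i => contDiff_apply ℝ ℝ i.succ))
    · have h1 : ∀ᶠ y : A in 𝓝 ⟨u, hWA huW⟩, f y = G (e y) := by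
        filter_upwards [e.continuous.continuousAt.eventually hGe] with y hy
        have : ((fun y : A => f y) ∘ φ.toHomeomorph.symm) (e y) = G (e y) := hy
        simpa [e] using this
      rw [nhds_subtype_eq_comap, eventually_comap] at h1
      filter_upwards [h1, hU u hu] with y hy hy'
      rw [hy ⟨y, hWA hy'.2⟩ rfl, hval y hy'.2]
      simp [hy'.1]

end LocalModel

/-! ### Integral curves of derivations -/

section IntegralCurves

variable {P : Type*} [TopologicalSpace P] [DifferentialSpace P]

/-- Convergence in a differential space is tested by its smooth functions. -/
theorem tendsto_of_smoothFn {Y : Type*} {l : Filter Y} {g : Y → P} {x : P}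
    (h : ∀ f ∈ SmoothFn P, Tendsto (fun y => f (g y)) l (𝓝 (f x))) : Tendsto g l (𝓝 x) := by
  have hgen := TopologicalSpace.nhds_generateFrom
    (g := {V : Set P | ∃ f ∈ SmoothFn P, ∃ a b : ℝ, V = f ⁻¹' Ioo a b}) (a := x)
  rw [← DifferentialSpace.generate (P := P)] at hgen
  rw [hgen]
  refine tendsto_iInf.2 fun V => tendsto_iInf.2 fun hV => tendsto_principal.2 ?_
  obtain ⟨hx, f, hf, a, b, rfl⟩ := hV
  exact (h f hf).eventually (isOpen_Ioo.mem_nhds hx)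

/-- The smoothness required of integral curves is automatic: the derivative of `f ∘ c` is
`(X f) ∘ c`, which is again differentiable. -/
theorem isIntegralCurveOfDerivation_of_hasDerivWithinAt
    {X : Derivation ℝ (SmoothFn P) (SmoothFn P)} {c : ℝ → P} {t : ℝ}
    (h : ∀ f : SmoothFn P, ∀ r ∈ uIcc 0 t,
      HasDerivWithinAt (fun s => (f : P → ℝ) (c s)) ((X f : P → ℝ) (c r)) (uIcc 0 t) r) :
    IsIntegralCurveOfDerivation X c (uIcc 0 t) := by
  refine fun f => ⟨?_, h f⟩
  rcases eq_or_ne 0 t with rfl | ht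
  · rw [uIcc_self]
    intro r hr
    rw [mem_singleton_iff.1 hr]
    exact contDiffWithinAt_singleton
  · have hu := uniqueDiffOn_uIcc ht
    refine contDiffOn_infty.2 fun n => ?_
    induction n generalizing f with
    | zero =>
      exact contDiffOn_zero.2 fun r hr => (h f r hr).continuousWithinAt
    | succ n ih =>
      rw [Nat.cast_add, Nat.cast_one, contDiffOn_succ_iff_derivWithin hu]
      refine ⟨fun r hr => (h f r hr).differentiableWithinAt, by simp, ?_⟩
      exact (ih (X f)).congr fun r hr => (h f r hr).derivWithin (hu r hr)

variable {X : Derivation ℝ (SmoothFn P) (SmoothFn P)}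

theorem IsIntegralCurveOfDerivation.continuousOn {c : ℝ → P} {I : Set ℝ}
    (h : IsIntegralCurveOfDerivation X c I) : ContinuousOn c I := fun r hr =>
  tendsto_of_smoothFn fun f hf => ((h ⟨f, hf⟩).2 r hr).continuousWithinAt

/-- Any two points of an integral curve are related by the flow. -/
theorem IsIntegralCurveOfDerivation.expRel {c : ℝ → P} {t : ℝ}
    (h : IsIntegralCurveOfDerivation X c (uIcc 0 t)) {a b : ℝ} (ha : a ∈ uIcc 0 t)
    (hb : b ∈ uIcc 0 t) : ExpRel X (b - a) (c a) (c b) := by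
  refine ⟨fun s => c (a + s), ?_, by simp, by simp⟩
  have hm : MapsTo (fun s => a + s) (uIcc 0 (b - a)) (uIcc 0 t) := by
    intro s hs
    refine uIcc_subset_uIcc ha hb ?_
    have : a + s ∈ (fun s => a + s) '' uIcc 0 (b - a) := mem_image_of_mem _ hs
    rw [image_const_add_uIcc] at this
    simpa using this
  refine isIntegralCurveOfDerivation_of_hasDerivWithinAt fun f r hr => ?_
  have h1 := ((h f).2 (a + r) (hm hr)).scomp r ((hasDerivWithinAt_id r _).const_add a) hm
  rw [one_smul] at h1
  exact h1

theorem ExpRel.refl (x : P) : ExpRel X 0 x x := by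
  refine ⟨fun _ => x, isIntegralCurveOfDerivation_of_hasDerivWithinAt fun f r hr => ?_, rfl, rfl⟩
  rw [uIcc_self] at hr ⊢
  rw [mem_singleton_iff.1 hr]
  exact HasFDerivWithinAt.of_subsingleton subsingleton_singleton

theorem ExpRel.symm {t : ℝ} {x y : P} (h : ExpRel X t x y) : ExpRel X (-t) y x := by
  obtain ⟨c, hc, rfl, rfl⟩ := h
  have := hc.expRel (a := t) (b := 0) right_mem_uIcc left_mem_uIcc
  rwa [zero_sub] at this

/-- Near each point, in a suitable local model `Φ`, every integral curve of a vector field follows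
for a short time the flow `Θ` of a smooth vector field on `ℝⁿ`. -/
theorem exists_local_flow (hP : IsSubcartesian P) (hX : IsVectorField X) (x : P) :
    ∃ (n : ℕ) (Φ : P → Fin n → ℝ) (U : Set P), IsLocalModel Φ U ∧
      ∃ ε > 0, ∃ V : Set P, IsOpen V ∧ x ∈ V ∧ ∃ Θ : ℝ × (Fin n → ℝ) → Fin n → ℝ,
        (∀ s p, |s| < ε → ContDiffAt ℝ ∞ Θ (s, p)) ∧
        ∀ y ∈ V, ∀ t, |t| < ε → (∃ z, ExpRel X t y z) ∧
          ∀ z, ExpRel X t y z → z ∈ U ∧ Φ z = Θ (t, Φ y) := by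
  obtain ⟨n, Φ, U, hxU, hΦ⟩ := exists_isLocalModel hP x
  choose G hG hGe using fun i => hΦ.extend x hxU _ (X ⟨_, hΦ.smooth i⟩).2
  obtain ⟨W, hW, hWc, hWG⟩ := exists_contDiff_hasCompactSupport_eventuallyEq isOpen_univ
    (k := fun p i => G i p) (fun p _ => (contDiff_pi.2 hG).contDiffAt) (mem_univ (Φ x))
  have hev : ∀ᶠ y in 𝓝 x, y ∈ U ∧ ∀ i, (X ⟨_, hΦ.smooth i⟩ : P → ℝ) y = W (Φ y) i := by
    filter_upwards [eventually_all.2 hGe, hΦ.continuous.continuousAt.eventually hWG,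
      hΦ.isOpen.mem_nhds hxU] with y hy hy1 hyU
    exact ⟨hyU, fun i => by rw [hy i, hy1]⟩
  rw [hΦ.nhds_eq x hxU, eventually_comap] at hev
  obtain ⟨r, hr, hball⟩ := Metric.eventually_nhds_iff.1 hev
  obtain ⟨M, hM⟩ := hW.continuous.bounded_above_of_compact_support hWc
  have hM0 : 0 ≤ M := (norm_nonneg _).trans (hM (Φ x))
  obtain ⟨ε₁, hε₁, Θ, hΘ, -, hΘu⟩ := exists_smooth_flow hW hWc
  obtain ⟨U₀, hU₀, hxU₀, ε₀, hε₀, hexp⟩ := hX x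
  refine ⟨n, Φ, U, hΦ, min ε₁ (min ε₀ (r / (4 * (M + 1)))), by positivity,
    U₀ ∩ Φ ⁻¹' Metric.ball (Φ x) (r / 2), hU₀.inter (Metric.isOpen_ball.preimage hΦ.continuous),
    ⟨hxU₀, Metric.mem_ball_self (by positivity)⟩, Θ,
    fun s p hs => hΘ s p (hs.trans_le (min_le_left _ _)), fun y hy t ht => ?_⟩
  obtain ⟨ht1, ht2, ht3⟩ : |t| < ε₁ ∧ |t| < ε₀ ∧ |t| < r / (4 * (M + 1)) := by
    simpa only [lt_min_iff] using ht
  refine ⟨?_, fun z hz => ?_⟩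
  · obtain ⟨_, _, φ, hφ⟩ := hexp t ht2
    exact ⟨_, hφ ⟨y, hy.1⟩⟩
  obtain ⟨c, hc, rfl, rfl⟩ := hz
  have hd : ∀ s ∈ uIcc 0 t, HasDerivWithinAt (fun s => Φ (c s))
      (fun i => (X ⟨_, hΦ.smooth i⟩ : P → ℝ) (c s)) (uIcc 0 t) s := fun s hs =>
    hasDerivWithinAt_pi.2 fun i => (hc ⟨_, hΦ.smooth i⟩).2 s hs
  have hm : MapsTo (fun l : ℝ => l * t) (Icc 0 1) (uIcc 0 t) := by
    intro l hl
    rcases le_total 0 t with h | h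
    · rw [uIcc_of_le h]
      exact ⟨mul_nonneg hl.1 h, mul_le_of_le_one_left h hl.2⟩
    · rw [uIcc_of_ge h]
      exact ⟨by nlinarith [hl.1, hl.2], mul_nonpos_of_nonneg_of_nonpos hl.1 h⟩
  have htM : |t| * M < r / 4 := by
    rw [lt_div_iff₀ (by positivity)] at ht3
    nlinarith [abs_nonneg t]
  -- The curve moves with bounded speed in the model, so it stays in the ball where the
  -- derivation is represented by `W`.
  have htrap : ∀ l ∈ Icc (0 : ℝ) 1, ‖Φ (c (l * t)) - Φ x‖ ≤ r / 2 + r / 4 * l := by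
    have hd1 : ∀ l ∈ Icc (0 : ℝ) 1, HasDerivWithinAt (fun l => Φ (c (l * t)) - Φ x)
        (t • fun i => (X ⟨_, hΦ.smooth i⟩ : P → ℝ) (c (l * t))) (Icc 0 1) l := by
      intro l hl
      have h1 := (hd (l * t) (hm hl)).scomp l ((hasDerivWithinAt_id l _).mul_const t) hm
      rw [one_mul] at h1
      exact h1.sub_const _
    refine image_norm_le_of_norm_deriv_right_lt_deriv_boundary'
      (fun l hl => (hd1 l hl).continuousWithinAt)
      (fun l hl => (hd1 l ⟨hl.1, hl.2.le⟩).mono_of_mem_nhdsWithin (Icc_mem_nhdsGE_of_mem hl))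
      (B' := fun _ => r / 4) ?_ (by fun_prop) (fun l hl => ?_) fun l hl hl' => ?_
    · have := hy.2
      rw [mem_preimage, Metric.mem_ball, dist_eq_norm] at this
      simpa using this.le
    · have h1 := (((hasDerivAt_id l).const_mul (r / 4)).const_add (r / 2)).hasDerivWithinAt
        (s := Ici l)
      rw [mul_one] at h1
      exact h1
    · have h1 : dist (Φ (c (l * t))) (Φ x) < r := by
        rw [dist_eq_norm, hl']
        nlinarith [hl.1, hl.2]
      have h2 := (hball h1 _ rfl).2
      have h3 : (fun i => (X ⟨_, hΦ.smooth i⟩ : P → ℝ) (c (l * t))) = W (Φ (c (l * t))) :=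
        funext h2
      rw [h3, norm_smul, Real.norm_eq_abs]
      exact (mul_le_mul_of_nonneg_left (hM _) (abs_nonneg t)).trans_lt htM
  have hin : ∀ s ∈ uIcc 0 t, dist (Φ (c s)) (Φ x) < r := by
    intro s hs
    obtain ⟨l, hl, rfl⟩ : ∃ l ∈ Icc (0 : ℝ) 1, l * t = s := by
      rw [← segment_eq_uIcc, segment_eq_image] at hs
      obtain ⟨l, hl, rfl⟩ := hs
      exact ⟨l, hl, by simp⟩
    rw [dist_eq_norm]
    have := htrap l hl
    nlinarith [hl.1, hl.2]
  refine ⟨(hball (hin t right_mem_uIcc) _ rfl).1, ?_⟩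
  refine hΘu t _ ht1 (fun s => Φ (c s)) rfl fun s hs => ?_
  have h3 : (fun i => (X ⟨_, hΦ.smooth i⟩ : P → ℝ) (c s)) = W (Φ (c s)) :=
    funext (hball (hin s hs) _ rfl).2
  rw [← h3]
  exact hd s hs

/-- Integral curves of vector fields are unique. -/
theorem ExpRel.unique (hP : IsSubcartesian P) (hX : IsVectorField X) {t : ℝ} {x y y' : P}
    (h : ExpRel X t x y) (h' : ExpRel X t x y') : y = y' := by
  obtain ⟨c, hc, hc0, rfl⟩ := h
  obtain ⟨c', hc', hc0', rfl⟩ := h'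
  have := hP.1
  -- The condition `c a = c' a` is locally constant in `a`.
  have key := isPreconnected_uIcc.induction₂ (s := uIcc 0 t)
    (fun a b => c a = c' a ↔ c b = c' b) (fun a ha => ?_) (fun _ _ _ _ _ _ => Iff.trans)
    (fun _ _ _ _ => Iff.symm) (x := 0) (y := t) left_mem_uIcc right_mem_uIcc
  · exact key.1 (hc0.trans hc0'.symm)
  · by_cases hca : c a = c' a
    · obtain ⟨n, Φ, U, hΦ, ε, hε, V, hV, haV, Θ, -, hflow⟩ := exists_local_flow hP hX (c a)
      have hnear : ∀ᶠ b in 𝓝[uIcc 0 t] a, |b - a| < ε := by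
        refine nhdsWithin_le_nhds ?_
        filter_upwards [Metric.ball_mem_nhds a hε] with b hb
        rwa [Metric.mem_ball, Real.dist_eq] at hb
      filter_upwards [hnear, self_mem_nhdsWithin] with b hb hbJ
      have h1 := (hflow _ haV _ hb).2 _ (hc.expRel ha hbJ)
      have h2 := (hflow _ haV _ hb).2 (c' b) (by rw [hca]; exact hc'.expRel ha hbJ)
      exact iff_of_true hca (hΦ.eq_of_eq h2.1 (h1.2.trans h2.2.symm))
    · have h1 := ((hc.continuousOn a ha).prodMk_nhds (hc'.continuousOn a ha)).eventually
        (isClosed_diagonal.isOpen_compl.mem_nhds hca)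
      filter_upwards [h1] with b hb
      exact iff_of_false hca hb

end IntegralCurves

section Flows

variable {P : Type*} [TopologicalSpace P] [DifferentialSpace P]
  {X : Derivation ℝ (SmoothFn P) (SmoothFn P)}

theorem ExpRel.eq_of_zero {x y : P} (h : ExpRel X 0 x y) : y = x := by
  obtain ⟨c, -, rfl, rfl⟩ := h
  rfl

/-- Integral curves traversed in the same direction can be joined. -/
theorem ExpRel.trans_of_mul_nonneg {t s : ℝ} {x y z : P} (hts : 0 ≤ t * s)
    (h : ExpRel X t x y) (h' : ExpRel X s y z) : ExpRel X (t + s) x z := by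
  classical
  obtain ⟨c, hc, rfl, rfl⟩ := h
  obtain ⟨c', hc', hy, rfl⟩ := h'
  have hAB : ∀ r ∈ uIcc 0 t, r - t ∈ uIcc 0 s → r = t := by
    intro r hr hr'
    rw [mem_uIcc] at hr hr'
    rcases hr with hr | hr <;> rcases hr' with hr' | hr' <;> nlinarith
  have hJ : uIcc 0 (t + s) ⊆ uIcc 0 t ∪ uIcc t (t + s) := uIcc_subset_uIcc_union_uIcc
  have hB : ∀ r, r ∈ uIcc t (t + s) ↔ r - t ∈ uIcc 0 s := by
    intro r
    have := image_const_add_uIcc t 0 s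
    rw [add_zero] at this
    rw [← this]
    constructor
    · rintro ⟨a, ha, rfl⟩
      simpa using ha
    · exact fun ha => ⟨_, ha, by simp⟩
  set γ : ℝ → P := fun r => if r ∈ uIcc 0 t then c r else c' (r - t) with hγ
  have hγA : ∀ r ∈ uIcc 0 t, γ r = c r := fun r hr => if_pos hr
  have hγB : ∀ r ∈ uIcc t (t + s), γ r = c' (r - t) := by
    intro r hr
    by_cases hr' : r ∈ uIcc 0 t
    · have := hAB r hr' ((hB r).1 hr)
      subst this
      rw [hγA _ hr', sub_self, hy]
    · exact if_neg hr'
  have hmaps : MapsTo (fun r => r - t) (uIcc t (t + s)) (uIcc 0 s) := fun r hr => (hB r).1 hr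
  refine ⟨γ, isIntegralCurveOfDerivation_of_hasDerivWithinAt fun f r hr => ?_,
    hγA 0 left_mem_uIcc, by rw [hγB _ right_mem_uIcc, add_sub_cancel_left]⟩
  refine HasDerivWithinAt.mono ?_ hJ
  refine HasDerivWithinAt.union ?_ ?_
  · by_cases hr' : r ∈ uIcc 0 t
    · rw [hγA r hr']
      exact ((hc f).2 r hr').congr (fun q hq => by rw [hγA q hq]) (by rw [hγA r hr'])
    · exact HasFDerivWithinAt.of_notMem_closure fun h => hr' (isClosed_Icc.closure_subset h)
  · by_cases hr' : r ∈ uIcc t (t + s)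
    · rw [hγB r hr']
      have h1 := ((hc' f).2 (r - t) (hmaps hr')).scomp r
        ((hasDerivWithinAt_id r _).sub_const t) hmaps
      rw [one_smul] at h1
      exact h1.congr (fun q hq => by rw [hγB q hq]; rfl) (by rw [hγB r hr']; rfl)
    · exact HasFDerivWithinAt.of_notMem_closure fun h => hr' (isClosed_Icc.closure_subset h)

/-- Integral curves can be joined; when the direction changes, the second one runs back along the
first by uniqueness. -/
theorem ExpRel.trans (hP : IsSubcartesian P) (hX : IsVectorField X) {t s : ℝ} {x y z : P}
    (h : ExpRel X t x y) (h' : ExpRel X s y z) : ExpRel X (t + s) x z := by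
  rcases le_total 0 (t * s) with hts | hts
  · exact h.trans_of_mul_nonneg hts h'
  have main : ∀ {t s : ℝ} {x y z : P}, t * s ≤ 0 → |s| ≤ |t| → ExpRel X t x y → ExpRel X s y z →
      ExpRel X (t + s) x z := by
    intro t s x y z hts hst h h'
    obtain ⟨c, hc, rfl, rfl⟩ := h
    have hmem : t + s ∈ uIcc 0 t := by
      rw [mem_uIcc]
      rcases abs_cases t with ⟨h1, h2⟩ | ⟨h1, h2⟩ <;> rcases abs_cases s with ⟨h3, h4⟩ | ⟨h3, h4⟩
      · rcases h2.eq_or_lt with h5 | h5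
        · left; constructor <;> linarith
        · left; constructor <;> nlinarith
      · left; constructor <;> linarith
      · right; constructor <;> linarith
      · exfalso; nlinarith
    have h1 := hc.expRel (a := t) (b := t + s) right_mem_uIcc hmem
    rw [add_sub_cancel_left] at h1
    rw [h'.unique hP hX h1]
    have h2 := hc.expRel (a := 0) (b := t + s) left_mem_uIcc hmem
    rwa [sub_zero] at h2
  rcases le_total |s| |t| with hst | hst
  · exact main hts hst h h'
  · have h1 := main (t := -s) (s := -t) (by linarith) (by rwa [abs_neg, abs_neg]) h'.symm h.symm
    have h2 := h1.symm
    rwa [show -(-s + -t) = t + s by ring] at h2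

/-! ### Smoothness of flows -/

/-- Near `(t, x)` the flow of `X` is defined, and it is smooth in terms of a local model
around `x`. -/
def IsSmoothFlowAt (X : Derivation ℝ (SmoothFn P) (SmoothFn P)) (t : ℝ) (x : P) : Prop :=
  ∃ (n : ℕ) (Φ : P → Fin n → ℝ), (∀ i, (fun y => Φ y i) ∈ SmoothFn P) ∧
    ∃ g : ℝ × P → P, (∀ᶠ w in 𝓝 (t, x), ExpRel X w.1 w.2 (g w)) ∧
      ∀ f ∈ SmoothFn P, ∃ H : ℝ × (Fin n → ℝ) → ℝ, ContDiffAt ℝ ∞ H (t, Φ x) ∧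
        ∀ᶠ w in 𝓝 (t, x), f (g w) = H (w.1, Φ w.2)

theorem tendsto_of_forall_eventually_eq_comp {n : ℕ} {Φ : P → Fin n → ℝ}
    (hΦ : ∀ i, (fun y => Φ y i) ∈ SmoothFn P) {g : ℝ × P → P} {w₀ : ℝ × P}
    (hg : ∀ f ∈ SmoothFn P, ∃ H : ℝ × (Fin n → ℝ) → ℝ, ContDiffAt ℝ ∞ H (w₀.1, Φ w₀.2) ∧
      ∀ᶠ w in 𝓝 w₀, f (g w) = H (w.1, Φ w.2)) : Tendsto g (𝓝 w₀) (𝓝 (g w₀)) := by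
  have hΦc : Continuous Φ := continuous_pi fun i => SmoothFn.continuous (hΦ i)
  refine tendsto_of_smoothFn fun f hf => ?_
  obtain ⟨H, hH, hHe⟩ := hg f hf
  have h1 : Tendsto (fun w : ℝ × P => H (w.1, Φ w.2)) (𝓝 w₀) (𝓝 (H (w₀.1, Φ w₀.2))) :=
    hH.continuousAt.tendsto.comp (by
      have : Continuous fun w : ℝ × P => (w.1, Φ w.2) := by fun_prop
      exact this.tendsto w₀)
  rw [hHe.self_of_nhds]
  exact h1.congr' (hHe.mono fun w hw => hw.symm)

theorem IsSmoothFlowAt.comp (hP : IsSubcartesian P) (hX : IsVectorField X) {t s : ℝ} {x y : P}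
    (h : IsSmoothFlowAt X t x) (hxy : ExpRel X t x y) (h' : IsSmoothFlowAt X s y) :
    IsSmoothFlowAt X (t + s) x := by
  obtain ⟨n, Φ, hΦ, g, hg, hgf⟩ := h
  obtain ⟨m, Ψ, hΨ, k, hk, hkf⟩ := h'
  have hgy : g (t, x) = y := (hg.self_of_nhds).unique hP hX hxy
  have hx : Tendsto (fun w : ℝ × P => (t, w.2)) (𝓝 (t + s, x)) (𝓝 (t, x)) := by
    have : Continuous fun w : ℝ × P => (t, w.2) := by fun_prop
    exact this.tendsto (t + s, x)
  have hgt : Tendsto g (𝓝 (t, x)) (𝓝 y) := by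
    have := tendsto_of_forall_eventually_eq_comp (w₀ := (t, x)) hΦ hgf
    rwa [hgy] at this
  have hkt : Tendsto (fun w : ℝ × P => (w.1 - t, g (t, w.2))) (𝓝 (t + s, x)) (𝓝 (s, y)) := by
    refine Tendsto.prodMk_nhds ?_ (hgt.comp hx)
    have : Continuous fun w : ℝ × P => w.1 - t := by fun_prop
    have h1 := this.tendsto (t + s, x)
    simpa using h1
  choose HΨ hHΨ hHΨe using fun i => hgf _ (hΨ i)
  refine ⟨n, Φ, hΦ, fun w => k (w.1 - t, g (t, w.2)), ?_, fun f hf => ?_⟩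
  · filter_upwards [hx.eventually hg, hkt.eventually hk] with w hw1 hw2
    have := hw1.trans hP hX hw2
    simpa using this
  · obtain ⟨H, hH, hHe⟩ := hkf f hf
    refine ⟨fun z => H (z.1 - t, fun i => HΨ i (t, z.2)), ?_, ?_⟩
    · have hval : (fun i => HΨ i (t, Φ x)) = Ψ y := by
        funext i
        have := (hHΨe i).self_of_nhds
        rw [hgy] at this
        exact this.symm
      refine ContDiffAt.comp (t + s, Φ x) (g := H)
        (f := fun z : ℝ × (Fin n → ℝ) => (z.1 - t, fun i => HΨ i (t, z.2))) ?_ ?_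
      · simpa [hval] using hH
      · refine (contDiffAt_fst.sub contDiffAt_const).prodMk (contDiffAt_pi.2 fun i => ?_)
        exact ContDiffAt.comp (t + s, Φ x) (g := HΨ i)
          (f := fun z : ℝ × (Fin n → ℝ) => (t, z.2)) (hHΨ i)
          (contDiffAt_const.prodMk contDiffAt_snd)
    · filter_upwards [hkt.eventually hHe, hx.eventually (eventually_all.2 hHΨe)] with w hw1 hw2
      rw [hw1]
      congr 2
      funext i
      exact hw2 i

/-- The flow of a vector field is smooth for short times, uniformly near each point. -/
theorem exists_isSmoothFlowAt (hP : IsSubcartesian P) (hX : IsVectorField X) (x : P) :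
    ∃ ε > 0, ∃ V : Set P, IsOpen V ∧ x ∈ V ∧ ∀ y ∈ V, ∀ t, |t| < ε → IsSmoothFlowAt X t y := by
  classical
  obtain ⟨n, Φ, U, hΦ, ε, hε, V, hV, hxV, Θ, hΘ, hflow⟩ := exists_local_flow hP hX x
  refine ⟨ε, hε, V, hV, hxV, fun y hy t ht => ?_⟩
  let g : ℝ × P → P := fun w => if h : ∃ z, ExpRel X w.1 w.2 z then h.choose else w.2
  have hnear : ∀ᶠ w : ℝ × P in 𝓝 (t, y), |w.1| < ε ∧ w.2 ∈ V :=
    ((continuous_abs.comp continuous_fst).continuousAt.eventually_lt continuousAt_const ht).and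
      (continuous_snd.continuousAt.eventually (hV.mem_nhds hy))
  have hg : ∀ᶠ w in 𝓝 (t, y), ExpRel X w.1 w.2 (g w) := by
    filter_upwards [hnear] with w hw
    have h1 := (hflow _ hw.2 _ hw.1).1
    simp only [g, dif_pos h1]
    exact h1.choose_spec
  have hgΦ : ∀ᶠ w in 𝓝 (t, y), g w ∈ U ∧ Φ (g w) = Θ (w.1, Φ w.2) := by
    filter_upwards [hnear, hg] with w hw hw'
    exact (hflow _ hw.2 _ hw.1).2 _ hw'
  obtain ⟨hgU, hgy⟩ := hgΦ.self_of_nhds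
  have hΦc := hΦ.continuous
  have hgt : Tendsto g (𝓝 (t, y)) (𝓝 (g (t, y))) := by
    rw [hΦ.nhds_eq _ hgU, tendsto_comap_iff, hgy]
    refine Tendsto.congr' (hgΦ.mono fun w hw => hw.2.symm) ?_
    refine (hΘ t (Φ y) ht).continuousAt.tendsto.comp ?_
    have : Continuous fun w : ℝ × P => (w.1, Φ w.2) := by fun_prop
    exact this.tendsto (t, y)
  refine ⟨n, Φ, hΦ.smooth, g, hg, fun f hf => ?_⟩
  obtain ⟨F, hF, hFe⟩ := hΦ.extend _ hgU f hf
  refine ⟨fun z => F (Θ z), hF.contDiffAt.comp _ (hΘ t (Φ y) ht), ?_⟩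
  filter_upwards [hgt.eventually hFe, hgΦ] with w hw hw'
  rw [hw, hw'.2]

/-- Flows of vector fields have open domains and are jointly smooth. For long times this follows
by composing the flows for short times along the integral curve. -/
theorem ExpRel.isSmoothFlowAt (hP : IsSubcartesian P) (hX : IsVectorField X) {t : ℝ} {x y : P}
    (h : ExpRel X t x y) : IsSmoothFlowAt X t x := by
  obtain ⟨c, hc, hc0, -⟩ := h
  have hx : ∀ a ∈ uIcc 0 t, ExpRel X a x (c a) := by
    intro a ha
    have := hc.expRel left_mem_uIcc ha
    rwa [hc0, sub_zero] at this
  have key := isPreconnected_uIcc.induction₂ (s := uIcc 0 t)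
    (fun a b => IsSmoothFlowAt X a x ↔ IsSmoothFlowAt X b x) (fun a ha => ?_)
    (fun _ _ _ _ _ _ => Iff.trans) (fun _ _ _ _ => Iff.symm) (x := 0) (y := t)
    left_mem_uIcc right_mem_uIcc
  · obtain ⟨ε, hε, V, -, hxV, hV⟩ := exists_isSmoothFlowAt hP hX x
    exact key.1 (hV x hxV 0 (by simpa using hε))
  · obtain ⟨ε, hε, V, hVo, haV, hV⟩ := exists_isSmoothFlowAt hP hX (c a)
    have hnear : ∀ᶠ b in 𝓝[uIcc 0 t] a, |b - a| < ε := by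
      refine nhdsWithin_le_nhds ?_
      filter_upwards [Metric.ball_mem_nhds a hε] with b hb
      rwa [Metric.mem_ball, Real.dist_eq] at hb
    filter_upwards [hnear, (hc.continuousOn a ha).eventually (hVo.mem_nhds haV),
      self_mem_nhdsWithin] with b hb hbV hbJ
    constructor
    · intro h1
      have := h1.comp hP hX (hx a ha) (hV _ haV (b - a) hb)
      rwa [add_sub_cancel] at this
    · intro h1
      have := h1.comp hP hX (hx b hbJ) (hV _ hbV (a - b) (by rwa [abs_sub_comm]))
      rwa [add_sub_cancel] at this

end Flows

/-! ### Composed flows -/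

section ComposedFlows

variable {P : Type*} [TopologicalSpace P] [DifferentialSpace P]

theorem composedExpRel_succ {k : ℕ} {X : Fin (k + 1) → AllVectorFields P} {t : Fin (k + 1) → ℝ}
    {x y : P} : ComposedExpRel (k + 1) X t x y ↔
      ∃ w, ComposedExpRel k (Fin.tail X) (Fin.tail t) x w ∧ ExpRel (X 0).1 (t 0) w y := Iff.rfl

theorem composedExpRel_cons {k : ℕ} {X : AllVectorFields P} {Y : Fin k → AllVectorFields P}
    {s : ℝ} {t : Fin k → ℝ} {x y : P} :
    ComposedExpRel (k + 1) (Fin.cons X Y : Fin (k + 1) → AllVectorFields P)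
      (Fin.cons s t : Fin (k + 1) → ℝ) x y ↔
      ∃ w, ComposedExpRel k Y t x w ∧ ExpRel X.1 s w y := by
  rw [composedExpRel_succ, Fin.tail_cons, Fin.tail_cons, Fin.cons_zero, Fin.cons_zero]

theorem ComposedExpRel.unique (hP : IsSubcartesian P) {k : ℕ} {X : Fin k → AllVectorFields P}
    {t : Fin k → ℝ} {x y y' : P} (h : ComposedExpRel k X t x y)
    (h' : ComposedExpRel k X t x y') : y = y' := by
  induction k generalizing y y' with
  | zero => exact Eq.trans h (Eq.symm h')
  | succ k ih =>
    obtain ⟨w, hw, hy⟩ := h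
    obtain ⟨w', hw', hy'⟩ := h'
    obtain rfl := ih hw hw'
    exact hy.unique hP (X 0).2 hy'

/-- A flow that is applied before a composed flow can be absorbed into it. -/
theorem exists_composedExpRel_iff_first (k : ℕ) (X : Fin k → AllVectorFields P) (t : Fin k → ℝ)
    (Y : AllVectorFields P) (s : ℝ) :
    ∃ (k' : ℕ) (X' : Fin k' → AllVectorFields P) (t' : Fin k' → ℝ),
      ∀ w w', ComposedExpRel k' X' t' w w' ↔ ∃ v, ExpRel Y.1 s w v ∧ ComposedExpRel k X t v w' := by
  induction k with
  | zero =>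
    refine ⟨1, fun _ => Y, fun _ => s, fun w w' => ?_⟩
    constructor
    · rintro ⟨v, rfl, h⟩
      exact ⟨w', h, rfl⟩
    · rintro ⟨v, h, rfl⟩
      exact ⟨w, rfl, h⟩
  | succ k ih =>
    obtain ⟨k', X', t', h⟩ := ih (Fin.tail X) (Fin.tail t)
    refine ⟨k' + 1, Fin.cons (X 0) X', Fin.cons (t 0) t', fun w w' => ?_⟩
    rw [composedExpRel_cons]
    constructor
    · rintro ⟨u, hu, hu'⟩
      obtain ⟨v, hv, hv'⟩ := (h _ _).1 hu
      exact ⟨v, hv, u, hv', hu'⟩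
    · rintro ⟨v, hv, u, hu, hu'⟩
      exact ⟨u, (h _ _).2 ⟨v, hv, hu⟩, hu'⟩

/-- Composed flows can be inverted. -/
theorem exists_composedExpRel_iff_swap (k : ℕ) (X : Fin k → AllVectorFields P) (t : Fin k → ℝ) :
    ∃ (k' : ℕ) (X' : Fin k' → AllVectorFields P) (t' : Fin k' → ℝ),
      ∀ w w', ComposedExpRel k' X' t' w w' ↔ ComposedExpRel k X t w' w := by
  induction k with
  | zero => exact ⟨0, X, t, fun w w' => eq_comm⟩
  | succ k ih =>
    obtain ⟨k₁, X₁, t₁, h₁⟩ := ih (Fin.tail X) (Fin.tail t)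
    obtain ⟨k₂, X₂, t₂, h₂⟩ := exists_composedExpRel_iff_first k₁ X₁ t₁ (X 0) (-t 0)
    refine ⟨k₂, X₂, t₂, fun w w' => ?_⟩
    rw [h₂]
    constructor
    · rintro ⟨v, hv, hv'⟩
      exact ⟨v, (h₁ _ _).1 hv', by simpa using hv.symm⟩
    · rintro ⟨v, hv, hv'⟩
      exact ⟨v, hv'.symm, (h₁ _ _).2 hv⟩

theorem self_mem_vfOrbit (x : P) : x ∈ vfOrbit x :=
  ⟨0, Fin.elim0, Fin.elim0, rfl⟩

theorem ExpRel.mem_vfOrbit {X : AllVectorFields P} {t : ℝ} {x y z : P} (hy : y ∈ vfOrbit x)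
    (h : ExpRel X.1 t y z) : z ∈ vfOrbit x := by
  obtain ⟨k, Y, s, hs⟩ := hy
  exact ⟨k + 1, Fin.cons X Y, Fin.cons t s, composedExpRel_cons.2 ⟨y, hs, h⟩⟩

theorem ComposedExpRel.mem_vfOrbit {k : ℕ} {X : Fin k → AllVectorFields P} {t : Fin k → ℝ}
    {x y z : P} (hy : y ∈ vfOrbit x) (h : ComposedExpRel k X t y z) : z ∈ vfOrbit x := by
  induction k generalizing z with
  | zero =>
    obtain rfl : z = y := h
    exact hy
  | succ k ih =>
    obtain ⟨w, hw, hz⟩ := h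
    exact hz.mem_vfOrbit (ih hw)

theorem mem_vfOrbit_symm {x y : P} (h : y ∈ vfOrbit x) : x ∈ vfOrbit y := by
  obtain ⟨k, X, t, h⟩ := h
  obtain ⟨k', X', t', h'⟩ := exists_composedExpRel_iff_swap k X t
  exact ⟨k', X', t', (h' _ _).2 h⟩

theorem mem_vfOrbit_trans {x y z : P} (h : y ∈ vfOrbit x) (h' : z ∈ vfOrbit y) :
    z ∈ vfOrbit x := by
  obtain ⟨k, X, t, h'⟩ := h'
  exact h'.mem_vfOrbit h

theorem vfOrbit_eq_of_mem {x y : P} (h : y ∈ vfOrbit x) : vfOrbit y = vfOrbit x :=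
  Subset.antisymm (fun _ hz => mem_vfOrbit_trans h hz)
    fun _ hz => mem_vfOrbit_trans (mem_vfOrbit_symm h) hz

theorem isPartition_vfOrbits : Setoid.IsPartition (vfOrbits P) := by
  refine ⟨?_, fun x => ⟨vfOrbit x, ⟨⟨x, rfl⟩, self_mem_vfOrbit x⟩, ?_⟩⟩
  · rintro ⟨x, hx⟩
    have := self_mem_vfOrbit x
    rw [hx] at this
    exact this
  · rintro _ ⟨⟨y, rfl⟩, hy⟩
    exact (vfOrbit_eq_of_mem hy).symm

/-- The closure of an orbit is invariant under the flows of vector fields, which are continuous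
and preserve the orbit. -/
theorem ExpRel.mem_closure_vfOrbit (hP : IsSubcartesian P) {X : AllVectorFields P} {t : ℝ}
    {x y z : P} (hy : y ∈ closure (vfOrbit x)) (h : ExpRel X.1 t y z) :
    z ∈ closure (vfOrbit x) := by
  obtain ⟨n, Φ, hΦ, g, hg, hgf⟩ := h.isSmoothFlowAt hP X.2
  have hgt := tendsto_of_forall_eventually_eq_comp (w₀ := (t, y)) hΦ hgf
  rw [(hg.self_of_nhds).unique hP X.2 h] at hgt
  have hc : Tendsto (fun w : P => (t, w)) (𝓝 y) (𝓝 (t, y)) := by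
    have : Continuous fun w : P => (t, w) := by fun_prop
    exact this.tendsto y
  rw [mem_closure_iff_frequently] at hy ⊢
  refine (hgt.comp hc).frequently ?_
  refine (hy.and_eventually (hc.eventually hg)).mono fun w hw => ?_
  exact hw.2.mem_vfOrbit hw.1

theorem ComposedExpRel.mem_closure_vfOrbit (hP : IsSubcartesian P) {k : ℕ}
    {X : Fin k → AllVectorFields P} {t : Fin k → ℝ} {x y z : P} (hy : y ∈ closure (vfOrbit x))
    (h : ComposedExpRel k X t y z) : z ∈ closure (vfOrbit x) := by
  induction k generalizing z with
  | zero =>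
    obtain rfl : z = y := h
    exact hy
  | succ k ih =>
    obtain ⟨w, hw, hz⟩ := h
    exact hz.mem_closure_vfOrbit hP (ih hw)

theorem frontierCondition_vfOrbits (hP : IsSubcartesian P) : FrontierCondition (vfOrbits P) := by
  rintro _ ⟨x, rfl⟩ _ ⟨y, rfl⟩ ⟨z, hzy, hzx⟩
  by_cases h : vfOrbit y = vfOrbit x
  · exact Or.inl h
  · refine Or.inr fun w hw => ⟨?_, fun hwx => h ?_⟩
    · rw [← vfOrbit_eq_of_mem hzy] at hw
      obtain ⟨k, X, t, hw⟩ := hw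
      exact hw.mem_closure_vfOrbit hP hzx
    · rw [← vfOrbit_eq_of_mem hw, vfOrbit_eq_of_mem hwx]

end ComposedFlows

/-! ### Smooth families of points of an orbit -/

section OrbitMaps

variable {P : Type*} [TopologicalSpace P] [DifferentialSpace P]
  {E : Type*} [NormedAddCommGroup E] [NormedSpace ℝ E]

/-- Smoothness at a point of a map from a normed space to a differential space. -/
def IsSmoothIntoAt (ψ : E → P) (e : E) : Prop :=
  ∀ f ∈ SmoothFn P, ContDiffAt ℝ ∞ (fun e' => f (ψ e')) e

theorem IsSmoothIntoAt.continuousAt {ψ : E → P} {e : E} (h : IsSmoothIntoAt ψ e) :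
    ContinuousAt ψ e :=
  tendsto_of_smoothFn fun f hf => (h f hf).continuousAt

theorem IsSmoothIntoAt.contDiffAt_comp {ψ : E → P} {e : E} (h : IsSmoothIntoAt ψ e) {n : ℕ}
    {Φ : P → Fin n → ℝ} (hΦ : ∀ i, (fun y => Φ y i) ∈ SmoothFn P) :
    ContDiffAt ℝ ∞ (fun e' => Φ (ψ e')) e :=
  contDiffAt_pi.2 fun i => h _ (hΦ i)

/-- The tangent vectors along which all smooth functions on `P`, composed with `ψ`, have
derivative zero. It is the kernel of the derivative of `ψ` at `e` in any local model of `P`. -/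
def tangentKer (ψ : E → P) (e : E) : Submodule ℝ E :=
  ⨅ f : SmoothFn P, LinearMap.ker (fderiv ℝ (fun e' => (f : P → ℝ) (ψ e')) e : E →ₗ[ℝ] ℝ)

theorem mem_tangentKer {ψ : E → P} {e v : E} :
    v ∈ tangentKer ψ e ↔ ∀ f ∈ SmoothFn P, fderiv ℝ (fun e' => f (ψ e')) e v = 0 := by
  simp [tangentKer, Submodule.mem_iInf]

theorem IsLocalModel.mem_tangentKer {n : ℕ} {Φ : P → Fin n → ℝ} {U : Set P}
    (hΦ : IsLocalModel Φ U) {ψ : E → P} {e v : E} (hψ : IsSmoothIntoAt ψ e) (he : ψ e ∈ U)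
    (hv : fderiv ℝ (fun e' => Φ (ψ e')) e v = 0) : v ∈ tangentKer ψ e := by
  have hd : HasFDerivAt (fun e' => Φ (ψ e')) (fderiv ℝ (fun e' => Φ (ψ e')) e) e :=
    ((hψ.contDiffAt_comp hΦ.smooth).differentiableAt (by simp)).hasFDerivAt
  rw [_root_.mem_tangentKer]
  intro f hf
  obtain ⟨F, hF, hFe⟩ := hΦ.extend _ he f hf
  have h1 : (fun e' => f (ψ e')) =ᶠ[𝓝 e] fun e' => F (Φ (ψ e')) :=
    hψ.continuousAt.eventually hFe
  have h2 : HasFDerivAt (fun e' => F (Φ (ψ e'))) _ e :=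
    ((hF.differentiable (by simp)) (Φ (ψ e))).hasFDerivAt.comp e hd
  rw [h1.fderiv_eq, h2.fderiv, ContinuousLinearMap.comp_apply, hv, map_zero]

/-- The rank at `e` of a map into `P` is at most the dimension of a local model around its value. -/
theorem IsLocalModel.finrank_le [FiniteDimensional ℝ E] {n : ℕ} {Φ : P → Fin n → ℝ} {U : Set P}
    (hΦ : IsLocalModel Φ U) {ψ : E → P} {e : E} (hψ : IsSmoothIntoAt ψ e) (he : ψ e ∈ U) :
    Module.finrank ℝ E ≤ n + Module.finrank ℝ (tangentKer ψ e) := by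
  set D : E →ₗ[ℝ] (Fin n → ℝ) := (fderiv ℝ (fun e' => Φ (ψ e')) e : E →ₗ[ℝ] (Fin n → ℝ)) with hD
  have hker : LinearMap.ker D ≤ tangentKer ψ e := fun v hv => hΦ.mem_tangentKer hψ he hv
  have h1 := D.finrank_range_add_finrank_ker
  have h2 : Module.finrank ℝ (LinearMap.range D) ≤ n := by
    simpa using (LinearMap.range D).finrank_le
  have h3 := Submodule.finrank_mono hker
  omega

section Flow

variable {X : Derivation ℝ (SmoothFn P) (SmoothFn P)}

theorem ExpRel.exists_map {Y : Type*} [TopologicalSpace Y] (hP : IsSubcartesian P)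
    (hX : IsVectorField X) {ψ : Y → P} {e : Y} (hψ : ContinuousAt ψ e) {τ : Y → ℝ}
    (hτ : ContinuousAt τ e) {y : P} (h : ExpRel X (τ e) (ψ e) y) :
    ∃ ψ' : Y → P, ∀ᶠ e' in 𝓝 e, ExpRel X (τ e') (ψ e') (ψ' e') := by
  obtain ⟨n, Φ, hΦ, g, hg, -⟩ := h.isSmoothFlowAt hP hX
  exact ⟨fun e' => g (τ e', ψ e'), (hτ.prodMk hψ).eventually hg⟩

/-- Following the flow of `X` from `ψ e'` for the time `τ e'` is a smooth function of `τ e'` and of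
finitely many smooth functions of `ψ e'`. -/
theorem exists_contDiffAt_eq_comp (hP : IsSubcartesian P) (hX : IsVectorField X) {ψ ψ' : E → P}
    {e : E} (hψ : IsSmoothIntoAt ψ e) {τ : E → ℝ} (hτ : ContDiffAt ℝ ∞ τ e)
    (h : ∀ᶠ e' in 𝓝 e, ExpRel X (τ e') (ψ e') (ψ' e')) : ∃ (n : ℕ) (Φ : P → Fin n → ℝ),
      (∀ i, (fun y => Φ y i) ∈ SmoothFn P) ∧ ∀ f ∈ SmoothFn P, ∃ H : ℝ × (Fin n → ℝ) → ℝ,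
        ContDiffAt ℝ ∞ H (τ e, Φ (ψ e)) ∧
        (fun e' => f (ψ' e')) =ᶠ[𝓝 e] fun e' => H (τ e', Φ (ψ e')) := by
  obtain ⟨n, Φ, hΦ, g, hg, hgf⟩ := (h.self_of_nhds).isSmoothFlowAt hP hX
  refine ⟨n, Φ, hΦ, fun f hf => ?_⟩
  obtain ⟨H, hH, hHe⟩ := hgf f hf
  refine ⟨H, hH, ?_⟩
  have ht : Tendsto (fun e' => (τ e', ψ e')) (𝓝 e) (𝓝 (τ e, ψ e)) :=
    hτ.continuousAt.prodMk hψ.continuousAt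
  filter_upwards [h, ht.eventually hg, ht.eventually hHe] with e' h1 h2 h3
  rw [h1.unique hP hX h2, h3]

theorem IsSmoothIntoAt.flow (hP : IsSubcartesian P) (hX : IsVectorField X) {ψ ψ' : E → P}
    {e : E} (hψ : IsSmoothIntoAt ψ e) {τ : E → ℝ} (hτ : ContDiffAt ℝ ∞ τ e)
    (h : ∀ᶠ e' in 𝓝 e, ExpRel X (τ e') (ψ e') (ψ' e')) : IsSmoothIntoAt ψ' e := by
  obtain ⟨n, Φ, hΦ, hH⟩ := exists_contDiffAt_eq_comp hP hX hψ hτ h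
  intro f hf
  obtain ⟨H, hH, hHe⟩ := hH f hf
  refine ContDiffAt.congr_of_eventuallyEq ?_ hHe
  exact ContDiffAt.comp e (g := H) (f := fun e' => (τ e', Φ (ψ e'))) hH
    (hτ.prodMk (hψ.contDiffAt_comp hΦ))

/-- Following a flow preserves the tangent vectors in the kernel along which the time is constant to
first order. -/
theorem mem_tangentKer_flow (hP : IsSubcartesian P) (hX : IsVectorField X) {ψ ψ' : E → P}
    {e v : E} (hψ : IsSmoothIntoAt ψ e) {τ : E → ℝ} (hτ : ContDiffAt ℝ ∞ τ e)
    (h : ∀ᶠ e' in 𝓝 e, ExpRel X (τ e') (ψ e') (ψ' e')) (hv : v ∈ tangentKer ψ e)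
    (hτv : fderiv ℝ τ e v = 0) : v ∈ tangentKer ψ' e := by
  obtain ⟨n, Φ, hΦ, hH⟩ := exists_contDiffAt_eq_comp hP hX hψ hτ h
  rw [mem_tangentKer] at hv ⊢
  intro f hf
  obtain ⟨H, hH, hHe⟩ := hH f hf
  have h1 : HasFDerivAt τ _ e := (hτ.differentiableAt (by simp)).hasFDerivAt
  have h2 : HasFDerivAt (fun e' => Φ (ψ e'))
      (ContinuousLinearMap.pi fun i => fderiv ℝ (fun e' => Φ (ψ e') i) e) e :=
    hasFDerivAt_pi.2 fun i => ((hψ _ (hΦ i)).differentiableAt (by simp)).hasFDerivAt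
  have h3 : HasFDerivAt (fun e' => H (τ e', Φ (ψ e'))) _ e :=
    HasFDerivAt.comp e (g := H) (f := fun e' => (τ e', Φ (ψ e')))
      (hH.differentiableAt (by simp)).hasFDerivAt (h1.prodMk h2)
  rw [hHe.fderiv_eq, h3.fderiv]
  have h4 : (ContinuousLinearMap.pi fun i => fderiv ℝ (fun e' => Φ (ψ e') i) e) v = 0 := by
    ext i
    exact hv _ (hΦ i)
  rw [ContinuousLinearMap.comp_apply, ContinuousLinearMap.prod_apply, hτv, h4]
  exact map_zero _

end Flow

/-! ### Orbit maps and their rank -/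

theorem ContDiffAt.finTail {k : ℕ} {τ : E → Fin (k + 1) → ℝ} {e : E} (h : ContDiffAt ℝ ∞ τ e) :
    ContDiffAt ℝ ∞ (fun e' => Fin.tail (τ e')) e :=
  contDiffAt_pi.2 fun i => contDiffAt_pi.1 h i.succ

theorem ContDiffAt.finCons {k : ℕ} {τ : E → Fin k → ℝ} {σ : E → ℝ} {e : E}
    (hσ : ContDiffAt ℝ ∞ σ e) (h : ContDiffAt ℝ ∞ τ e) :
    ContDiffAt ℝ ∞ (fun e' => (Fin.cons (σ e') (τ e') : Fin (k + 1) → ℝ)) e :=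
  contDiffAt_pi.2 fun i => Fin.cases hσ (fun j => contDiffAt_pi.1 h j) i

/-- The values after the first `k` of `k + 1` composed flows, chosen as a function of the
parameter. -/
theorem exists_intermediate_map {Y : Type*} {l : Filter Y} {k : ℕ}
    {X : Fin (k + 1) → AllVectorFields P} {τ : Y → Fin (k + 1) → ℝ} {ψ ψ' : Y → P}
    (h : ∀ᶠ e in l, ComposedExpRel (k + 1) X (τ e) (ψ e) (ψ' e)) : ∃ χ : Y → P,
      (∀ᶠ e in l, ComposedExpRel k (Fin.tail X) (Fin.tail (τ e)) (ψ e) (χ e)) ∧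
      ∀ᶠ e in l, ExpRel (X 0).1 (τ e 0) (χ e) (ψ' e) := by
  have hw : ∀ e, ∃ w, ComposedExpRel (k + 1) X (τ e) (ψ e) (ψ' e) →
      ComposedExpRel k (Fin.tail X) (Fin.tail (τ e)) (ψ e) w ∧ ExpRel (X 0).1 (τ e 0) w (ψ' e) := by
    intro e
    by_cases he : ComposedExpRel (k + 1) X (τ e) (ψ e) (ψ' e)
    · obtain ⟨w, hw⟩ := he
      exact ⟨w, fun _ => hw⟩
    · exact ⟨ψ e, fun h => absurd h he⟩
  choose χ hχ using hw
  exact ⟨χ, h.mono fun e he => (hχ e he).1, h.mono fun e he => (hχ e he).2⟩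

theorem IsSmoothIntoAt.composedFlow (hP : IsSubcartesian P) {k : ℕ}
    {X : Fin k → AllVectorFields P} {ψ ψ' : E → P} {e : E} (hψ : IsSmoothIntoAt ψ e)
    {τ : E → Fin k → ℝ} (hτ : ContDiffAt ℝ ∞ τ e)
    (h : ∀ᶠ e' in 𝓝 e, ComposedExpRel k X (τ e') (ψ e') (ψ' e')) : IsSmoothIntoAt ψ' e := by
  induction k generalizing ψ' with
  | zero =>
    intro f hf
    exact (hψ f hf).congr_of_eventuallyEq (h.mono fun e' he' => congrArg f he')
  | succ k ih =>
    obtain ⟨χ, h1, h2⟩ := exists_intermediate_map h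
    exact (ih hτ.finTail h1).flow hP (X 0).2 (contDiffAt_pi.1 hτ 0) h2

theorem ComposedExpRel.exists_map {Y : Type*} [TopologicalSpace Y] (hP : IsSubcartesian P)
    {k : ℕ} {X : Fin k → AllVectorFields P} {ψ : Y → P} {e : Y} (hψ : ContinuousAt ψ e)
    {τ : Y → Fin k → ℝ} (hτ : ContinuousAt τ e) {y : P} (h : ComposedExpRel k X (τ e) (ψ e) y) :
    ∃ ψ' : Y → P, ContinuousAt ψ' e ∧
      ∀ᶠ e' in 𝓝 e, ComposedExpRel k X (τ e') (ψ e') (ψ' e') := by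
  induction k generalizing y with
  | zero => exact ⟨ψ, hψ, Eventually.of_forall fun _ => rfl⟩
  | succ k ih =>
    obtain ⟨w, hw, hy⟩ := h
    have hτ' : ContinuousAt (fun e' => Fin.tail (τ e')) e :=
      continuousAt_pi.2 fun i => continuousAt_pi.1 hτ i.succ
    obtain ⟨χ, hχ, hχe⟩ := ih hτ' hw
    obtain rfl := (hχe.self_of_nhds).unique hP hw
    obtain ⟨n, Φ, hΦ, g, hg, hgf⟩ := hy.isSmoothFlowAt hP (X 0).2
    have ht : Tendsto (fun e' => (τ e' 0, χ e')) (𝓝 e) (𝓝 (τ e 0, χ e)) :=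
      (continuousAt_pi.1 hτ 0).prodMk hχ
    refine ⟨fun e' => g (τ e' 0, χ e'), ?_, ?_⟩
    · exact (tendsto_of_forall_eventually_eq_comp (w₀ := (τ e 0, χ e)) hΦ hgf).comp ht
    · filter_upwards [hχe, ht.eventually hg] with e' h1 h2
      exact ⟨_, h1, h2⟩

theorem tangentKer_congr {ψ ψ' : E → P} {e : E} (h : ψ' =ᶠ[𝓝 e] ψ) :
    tangentKer ψ' e = tangentKer ψ e := by
  ext v
  rw [mem_tangentKer, mem_tangentKer]
  refine forall₂_congr fun f _ => ?_
  have h1 : (fun e' => f (ψ' e')) =ᶠ[𝓝 e] fun e' => f (ψ e') := h.fun_comp f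
  rw [h1.fderiv_eq]

/-- Composing with the flows of vector fields for fixed times does not change the kernel of the
derivative, since these flows are local diffeomorphisms. -/
theorem tangentKer_composedFlow (hP : IsSubcartesian P) {k : ℕ} {X : Fin k → AllVectorFields P}
    {t : Fin k → ℝ} {ψ ψ' : E → P} {e : E} (hψ : IsSmoothIntoAt ψ e)
    (h : ∀ᶠ e' in 𝓝 e, ComposedExpRel k X t (ψ e') (ψ' e')) :
    tangentKer ψ' e = tangentKer ψ e := by
  have le : ∀ {k : ℕ} {X : Fin k → AllVectorFields P} {t : Fin k → ℝ} {ψ ψ' : E → P},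
      IsSmoothIntoAt ψ e → (∀ᶠ e' in 𝓝 e, ComposedExpRel k X t (ψ e') (ψ' e')) →
      tangentKer ψ e ≤ tangentKer ψ' e := by
    intro k
    induction k with
    | zero =>
      intro X t ψ ψ' hψ h
      exact (tangentKer_congr (h.mono fun e' he' => he')).ge
    | succ k ih =>
      intro X t ψ ψ' hψ h
      obtain ⟨χ, h1, h2⟩ := exists_intermediate_map h
      intro v hv
      exact mem_tangentKer_flow hP (X 0).2 (hψ.composedFlow hP contDiffAt_const h1)
        contDiffAt_const h2 (ih hψ h1 hv) (by simp)
  refine le_antisymm ?_ (le hψ h)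
  obtain ⟨k', X', t', h'⟩ := exists_composedExpRel_iff_swap k X t
  exact le (hψ.composedFlow hP contDiffAt_const h) (h.mono fun e' he' => (h' _ _).2 he')

theorem mem_tangentKer_comp {E' : Type*} [NormedAddCommGroup E'] [NormedSpace ℝ E'] {ψ : E → P}
    {ρ : E' → E} {a v : E'} (hψ : IsSmoothIntoAt ψ (ρ a)) (hρ : DifferentiableAt ℝ ρ a) :
    v ∈ tangentKer (fun a' => ψ (ρ a')) a ↔ fderiv ℝ ρ a v ∈ tangentKer ψ (ρ a) := by
  rw [mem_tangentKer, mem_tangentKer]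
  refine forall₂_congr fun f hf => ?_
  have h1 : HasFDerivAt (fun a' => f (ψ (ρ a'))) _ a :=
    HasFDerivAt.comp a (g := fun e => f (ψ e))
      ((hψ f hf).differentiableAt (by simp)).hasFDerivAt hρ.hasFDerivAt
  rw [h1.fderiv, ContinuousLinearMap.comp_apply]

/-- Near `e`, the map `ψ` is given by composed flows applied to `x₀`, for times which depend
smoothly on the argument. -/
def IsOrbitMapAt (x₀ : P) (ψ : E → P) (e : E) : Prop :=
  ∃ (k : ℕ) (X : Fin k → AllVectorFields P) (τ : E → Fin k → ℝ),
    (∀ᶠ e' in 𝓝 e, ContDiffAt ℝ ∞ τ e') ∧ ∀ᶠ e' in 𝓝 e, ComposedExpRel k X (τ e') x₀ (ψ e')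

theorem isSmoothIntoAt_const (x₀ : P) (e : E) : IsSmoothIntoAt (fun _ => x₀) e :=
  fun _ _ => contDiffAt_const

namespace IsOrbitMapAt

variable {x₀ : P} {ψ : E → P} {e : E}

theorem const (x₀ : P) (e : E) : IsOrbitMapAt x₀ (fun _ => x₀) e :=
  ⟨0, Fin.elim0, fun _ => Fin.elim0, Eventually.of_forall fun _ => contDiffAt_const,
    Eventually.of_forall fun _ => rfl⟩

theorem isSmoothIntoAt (hP : IsSubcartesian P) (h : IsOrbitMapAt x₀ ψ e) : IsSmoothIntoAt ψ e := by
  obtain ⟨k, X, τ, hτ, h⟩ := h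
  exact (isSmoothIntoAt_const x₀ e).composedFlow hP hτ.self_of_nhds h

theorem mem_vfOrbit (h : IsOrbitMapAt x₀ ψ e) : ψ e ∈ vfOrbit x₀ := by
  obtain ⟨k, X, τ, -, h⟩ := h
  exact ⟨k, X, τ e, h.self_of_nhds⟩

theorem eventually (h : IsOrbitMapAt x₀ ψ e) : ∀ᶠ e' in 𝓝 e, IsOrbitMapAt x₀ ψ e' := by
  obtain ⟨k, X, τ, hτ, h⟩ := h
  filter_upwards [hτ.eventually_nhds, h.eventually_nhds] with e' h1 h2
  exact ⟨k, X, τ, h1, h2⟩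

theorem comp {E' : Type*} [NormedAddCommGroup E'] [NormedSpace ℝ E'] {ρ : E' → E} {a : E'}
    (h : IsOrbitMapAt x₀ ψ (ρ a)) (hρ : ∀ᶠ a' in 𝓝 a, ContDiffAt ℝ ∞ ρ a') :
    IsOrbitMapAt x₀ (fun a' => ψ (ρ a')) a := by
  obtain ⟨k, X, τ, hτ, h⟩ := h
  have hc : Tendsto ρ (𝓝 a) (𝓝 (ρ a)) := hρ.self_of_nhds.continuousAt
  refine ⟨k, X, fun a' => τ (ρ a'), ?_, hc.eventually h⟩
  filter_upwards [hρ, hc.eventually hτ] with a' h1 h2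
  exact h2.comp a' h1

theorem flow (h : IsOrbitMapAt x₀ ψ e) {Y : AllVectorFields P} {s : E → ℝ} {ψ' : E → P}
    (hs : ∀ᶠ e' in 𝓝 e, ContDiffAt ℝ ∞ s e')
    (h' : ∀ᶠ e' in 𝓝 e, ExpRel Y.1 (s e') (ψ e') (ψ' e')) : IsOrbitMapAt x₀ ψ' e := by
  obtain ⟨k, X, τ, hτ, h⟩ := h
  refine ⟨k + 1, Fin.cons Y X, fun e' => Fin.cons (s e') (τ e'), ?_, ?_⟩
  · filter_upwards [hs, hτ] with e' h1 h2
    exact h1.finCons h2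
  · filter_upwards [h, h'] with e' h1 h2
    exact composedExpRel_cons.2 ⟨_, h1, h2⟩

theorem composedFlow (h : IsOrbitMapAt x₀ ψ e) {k : ℕ} {X : Fin k → AllVectorFields P}
    {τ : E → Fin k → ℝ} {ψ' : E → P} (hτ : ∀ᶠ e' in 𝓝 e, ContDiffAt ℝ ∞ τ e')
    (h' : ∀ᶠ e' in 𝓝 e, ComposedExpRel k X (τ e') (ψ e') (ψ' e')) : IsOrbitMapAt x₀ ψ' e := by
  induction k generalizing ψ' with
  | zero =>
    obtain ⟨k, X, σ, hσ, h⟩ := h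
    refine ⟨k, X, σ, hσ, ?_⟩
    filter_upwards [h, h'] with e' h1 h2
    rwa [show ψ' e' = ψ e' from h2]
  | succ k ih =>
    obtain ⟨χ, h1, h2⟩ := exists_intermediate_map h'
    exact (ih (hτ.mono fun e' he' => he'.finTail) h1).flow
      (hτ.mono fun e' he' => contDiffAt_pi.1 he' 0) h2

end IsOrbitMapAt

/-- A number `m` bounds the rank of all orbit maps with base point `x₀`. -/
def IsRankBound (x₀ : P) (m : ℕ) : Prop :=
  ∀ (E : Type) [NormedAddCommGroup E] [NormedSpace ℝ E] [FiniteDimensional ℝ E]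
    (ψ : E → P) (e : E), IsOrbitMapAt x₀ ψ e →
      Module.finrank ℝ E ≤ m + Module.finrank ℝ (tangentKer ψ e)

/-- The rank of orbit maps is bounded, since every orbit map can be transported to the base point
`x₀` without changing its rank. -/
theorem exists_isRankBound (hP : IsSubcartesian P) (x₀ : P) : ∃ n : ℕ, IsRankBound x₀ n := by
  obtain ⟨n, Φ, U, hxU, hΦ⟩ := exists_isLocalModel hP x₀
  refine ⟨n, fun E _ _ _ ψ e hψ => ?_⟩
  obtain ⟨k, X, t, ht⟩ := mem_vfOrbit_symm hψ.mem_vfOrbit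
  have hs := hψ.isSmoothIntoAt hP
  obtain ⟨ψ', -, hψ'⟩ := ComposedExpRel.exists_map hP (τ := fun _ : E => t) hs.continuousAt
    continuousAt_const ht
  rw [← tangentKer_composedFlow hP hs hψ']
  refine hΦ.finrank_le (hs.composedFlow hP contDiffAt_const hψ') ?_
  rwa [(hψ'.self_of_nhds).unique hP ht]

/-- The maximal rank `m` of orbit maps is attained by an immersion of `ℝ^m` at every point of
the orbit. -/
theorem exists_dimension (hP : IsSubcartesian P) (x₀ : P) :
    ∃ m : ℕ, IsRankBound x₀ m ∧ ∀ z ∈ vfOrbit x₀, ∃ σ : EuclideanSpace ℝ (Fin m) → P,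
      IsOrbitMapAt x₀ σ 0 ∧ σ 0 = z ∧ tangentKer σ 0 = ⊥ := by
  obtain ⟨n, hn⟩ := exists_isRankBound hP x₀
  let R : Set ℕ := {r | ∃ (E : Type) (_ : NormedAddCommGroup E) (_ : NormedSpace ℝ E)
    (_ : FiniteDimensional ℝ E) (ψ : E → P) (e : E), IsOrbitMapAt x₀ ψ e ∧
      Module.finrank ℝ E = r + Module.finrank ℝ (tangentKer ψ e)}
  have hne : R.Nonempty := by
    refine ⟨Module.finrank ℝ ℝ - Module.finrank ℝ (tangentKer (fun _ : ℝ => x₀) 0),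
      ℝ, inferInstance, inferInstance, inferInstance, fun _ => x₀, 0, IsOrbitMapAt.const x₀ 0, ?_⟩
    exact (Nat.sub_add_cancel (Submodule.finrank_le _)).symm
  have hbdd : BddAbove R := by
    refine ⟨n, ?_⟩
    rintro r ⟨E, _, _, _, ψ, e, hψ, hr⟩
    have := hn E ψ e hψ
    omega
  obtain ⟨E, _, _, _, ψ, e, hψ, hm⟩ := Nat.sSup_mem hne hbdd
  refine ⟨sSup R, fun E' _ _ _ ψ' e' hψ' => ?_, fun z hz => ?_⟩
  · have h1 : Module.finrank ℝ E' - Module.finrank ℝ (tangentKer ψ' e') ≤ sSup R :=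
      le_csSup hbdd ⟨E', _, _, ‹_›, ψ', e', hψ',
        (Nat.sub_add_cancel (Submodule.finrank_le _)).symm⟩
    omega
  · have hs := hψ.isSmoothIntoAt hP
    obtain ⟨k, X, t, ht⟩ : z ∈ vfOrbit (ψ e) :=
      mem_vfOrbit_trans (mem_vfOrbit_symm hψ.mem_vfOrbit) hz
    obtain ⟨ψ', -, hψ'⟩ := ComposedExpRel.exists_map hP (τ := fun _ : E => t) hs.continuousAt
      continuousAt_const ht
    have hψ'o : IsOrbitMapAt x₀ ψ' e :=
      hψ.composedFlow (Eventually.of_forall fun _ => contDiffAt_const) hψ'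
    have hker := tangentKer_composedFlow hP hs hψ'
    obtain ⟨L, hL⟩ := Submodule.exists_isCompl (tangentKer ψ e)
    have hdim : Module.finrank ℝ (EuclideanSpace ℝ (Fin (sSup R))) = Module.finrank ℝ L := by
      have := Submodule.finrank_add_eq_of_isCompl hL
      rw [finrank_euclideanSpace_fin]
      omega
    -- Restrict to a complement of the kernel, which has dimension `m`.
    let ι : EuclideanSpace ℝ (Fin (sSup R)) ≃L[ℝ] L := ContinuousLinearEquiv.ofFinrankEq hdim
    let ℓ : EuclideanSpace ℝ (Fin (sSup R)) →L[ℝ] E := L.subtypeL ∘L (ι : _ →L[ℝ] L)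
    have hρ : ContDiff ℝ ∞ fun u => e + ℓ u := contDiff_const.add ℓ.contDiff
    have h0 : e + ℓ 0 = e := by simp
    refine ⟨fun u => ψ' (e + ℓ u), ?_, ?_, ?_⟩
    · refine IsOrbitMapAt.comp (ρ := fun u => e + ℓ u) (by rwa [h0])
        (Eventually.of_forall fun u => hρ.contDiffAt)
    · simp only [h0]
      exact (hψ'.self_of_nhds).unique hP ht
    · rw [Submodule.eq_bot_iff]
      intro v hv
      rw [mem_tangentKer_comp (ρ := fun u => e + ℓ u) (by rw [h0]; exact hψ'o.isSmoothIntoAt hP)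
        ((hρ.differentiable (by simp)) 0)] at hv
      have hd : HasFDerivAt (fun u => e + ℓ u) ℓ 0 := ℓ.hasFDerivAt.const_add e
      rw [hd.fderiv, h0, hker] at hv
      have h1 : (ι v : E) ∈ tangentKer ψ e ⊓ L := ⟨hv, (ι v).2⟩
      rw [hL.inf_eq_bot, Submodule.mem_bot] at h1
      have h2 : ι v = 0 := Subtype.ext h1
      simpa using h2

end OrbitMaps

/-! ### Plaques of an orbit -/

section Plaques

variable {P : Type*} [TopologicalSpace P] [DifferentialSpace P]

/-- A plaque of the orbit of `x₀`: a smooth parametrization `σ` of a piece of the orbit by an open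
subset `B` of `ℝ^m`, with a smooth left inverse `q` that is defined on all of `P`. -/
structure IsPlaque (x₀ : P) {m : ℕ} (σ : EuclideanSpace ℝ (Fin m) → P)
    (q : P → EuclideanSpace ℝ (Fin m)) (B : Set (EuclideanSpace ℝ (Fin m))) : Prop where
  isOpen : IsOpen B
  smooth : ∀ i, (fun y => q y i) ∈ SmoothFn P
  isOrbitMapAt : ∀ u ∈ B, IsOrbitMapAt x₀ σ u
  leftInv : ∀ u ∈ B, q (σ u) = u

/-- By the inverse function theorem, every immersive orbit map is a plaque after a change of
parameters `κ`. -/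
theorem exists_isPlaque (hP : IsSubcartesian P) {x₀ : P} {m : ℕ}
    {σ : EuclideanSpace ℝ (Fin m) → P} {u : EuclideanSpace ℝ (Fin m)} (hσ : IsOrbitMapAt x₀ σ u)
    (hker : tangentKer σ u = ⊥) :
    ∃ (q : P → EuclideanSpace ℝ (Fin m)) (B : Set (EuclideanSpace ℝ (Fin m)))
      (κ : EuclideanSpace ℝ (Fin m) → EuclideanSpace ℝ (Fin m)),
      IsPlaque x₀ (fun v => σ (κ v)) q B ∧ q (σ u) ∈ B ∧ ContinuousAt κ (q (σ u)) ∧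
        ContinuousAt (fun u' => q (σ u')) u ∧ ∀ᶠ u' in 𝓝 u, κ (q (σ u')) = u' := by
  obtain ⟨n, Φ, U, hU, hΦ⟩ := exists_isLocalModel hP (σ u)
  have hσs := hσ.isSmoothIntoAt hP
  set D := fderiv ℝ (fun u' => Φ (σ u')) u with hD
  have hinj : LinearMap.ker (D : EuclideanSpace ℝ (Fin m) →ₗ[ℝ] (Fin n → ℝ)) = ⊥ := by
    rw [Submodule.eq_bot_iff]
    intro v hv
    have := hΦ.mem_tangentKer hσs hU hv
    rwa [hker, Submodule.mem_bot] at this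
  obtain ⟨p', hp'⟩ := LinearMap.exists_leftInverse_of_injective _ hinj
  let p : (Fin n → ℝ) →L[ℝ] EuclideanSpace ℝ (Fin m) := LinearMap.toContinuousLinearMap p'
  have hp : p ∘L D = ContinuousLinearMap.id ℝ _ := by
    ext1 v
    exact LinearMap.congr_fun hp' v
  have hqs : ∀ i, (fun y => p (Φ y) i) ∈ SmoothFn P := fun i =>
    SmoothFn.comp_contDiff hΦ.smooth (F := fun z => p z i)
      ((EuclideanSpace.proj i : EuclideanSpace ℝ (Fin m) →L[ℝ] ℝ).contDiff.comp p.contDiff)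
  let h : EuclideanSpace ℝ (Fin m) → EuclideanSpace ℝ (Fin m) := fun u' => p (Φ (σ u'))
  have hh : ∀ u', IsOrbitMapAt x₀ σ u' → ContDiffAt ℝ ∞ h u' := fun u' hu' =>
    p.contDiff.contDiffAt.comp u' ((hu'.isSmoothIntoAt hP).contDiffAt_comp hΦ.smooth)
  have hdu : HasFDerivAt h
      ((ContinuousLinearEquiv.refl ℝ (EuclideanSpace ℝ (Fin m)) :
        EuclideanSpace ℝ (Fin m) ≃L[ℝ] EuclideanSpace ℝ (Fin m)) :
        EuclideanSpace ℝ (Fin m) →L[ℝ] EuclideanSpace ℝ (Fin m)) u := by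
    have h1 : HasFDerivAt h (p ∘L D) u :=
      p.hasFDerivAt.comp u
        ((hσs.contDiffAt_comp hΦ.smooth).differentiableAt (by simp)).hasFDerivAt
    rw [hp] at h1
    exact h1
  let e := (hh u hσ).toOpenPartialHomeomorph h hdu (by simp)
  have hue : u ∈ e.source := (hh u hσ).mem_toOpenPartialHomeomorph_source hdu (by simp)
  have hinv : ∀ᶠ u' in 𝓝 u, fderiv ℝ h u' ∈
      range ((↑) : (EuclideanSpace ℝ (Fin m) ≃L[ℝ] EuclideanSpace ℝ (Fin m)) → _) := by
    have h1 : ContinuousAt (fderiv ℝ h) u :=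
      ((hh u hσ).fderiv_right (m := 0) (by simp)).continuousAt
    refine h1.eventually (ContinuousLinearEquiv.isOpen.mem_nhds ?_)
    rw [hdu.fderiv]
    exact mem_range_self _
  obtain ⟨O, hO, hOo, huO⟩ := mem_nhds_iff.1 (hinv.and hσ.eventually)
  refine ⟨fun y => p (Φ y), e.target ∩ e.symm ⁻¹' O, e.symm,
    ⟨e.symm.isOpen_inter_preimage hOo, hqs, fun v hv => ?_, fun v hv => e.right_inv hv.1⟩,
    ⟨e.map_source hue, ?_⟩, e.symm.continuousAt (e.map_source hue),
    (hh u hσ).continuousAt, ?_⟩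
  · refine IsOrbitMapAt.comp (hO hv.2).2 ?_
    filter_upwards [(e.symm.isOpen_inter_preimage hOo).mem_nhds hv] with w hw
    obtain ⟨⟨L, hL⟩, hw2⟩ := hO hw.2
    refine e.contDiffAt_symm (f₀' := L) hw.1 ?_ (hh _ hw2)
    have h1 : HasFDerivAt h (fderiv ℝ h (e.symm w)) (e.symm w) :=
      ((hh _ hw2).differentiableAt (by simp)).hasFDerivAt
    rw [← hL] at h1
    exact h1
  · have h1 : e.symm (e u) = u := e.left_inv hue
    have h2 : e.symm (e u) ∈ O := by rwa [h1]
    exact h2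
  · filter_upwards [e.open_source.mem_nhds hue] with u' hu'
    exact e.left_inv hu'

/-- Differentiability at `0` is assumed, since the integral curves defining `ExpRel` only give
one-sided derivatives there. -/
theorem hasDerivAt_comp_of_expRel (hP : IsSubcartesian P) (X : AllVectorFields P) {y : P}
    {Γ : ℝ → P} (hΓ : ∀ᶠ r in 𝓝 0, ExpRel X.1 r y (Γ r)) (f : SmoothFn P)
    (hf : DifferentiableAt ℝ (fun r => (f : P → ℝ) (Γ r)) 0) :
    HasDerivAt (fun r => (f : P → ℝ) (Γ r)) ((X.1 f : P → ℝ) y) 0 := by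
  obtain ⟨δ, hδ, hball⟩ := Metric.eventually_nhds_iff.1 hΓ
  have hr : dist (δ / 2) 0 < δ := by
    rw [Real.dist_eq, sub_zero, abs_of_pos (by positivity)]
    linarith
  obtain ⟨c, hc, rfl, -⟩ := hball hr
  have hcΓ : ∀ r ∈ uIcc 0 (δ / 2), Γ r = c r := by
    intro r hr
    have h1 := hc.expRel left_mem_uIcc hr
    rw [sub_zero] at h1
    refine (hball ?_).unique hP X.2 h1
    rw [uIcc_of_le (by positivity)] at hr
    rw [Real.dist_eq, sub_zero, abs_of_nonneg hr.1]
    linarith [hr.2]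
  have h1 : HasDerivWithinAt (fun r => (f : P → ℝ) (Γ r)) _ (uIcc 0 (δ / 2)) 0 :=
    ((hc f).2 0 left_mem_uIcc).congr (fun r hr => by rw [hcΓ r hr])
      (by rw [hcΓ 0 left_mem_uIcc])
  have hu : UniqueDiffWithinAt ℝ (uIcc 0 (δ / 2)) 0 :=
    uniqueDiffOn_uIcc (by positivity : δ / 2 ≠ 0).symm 0 left_mem_uIcc
  have h2 := hf.hasDerivAt
  rwa [hu.eq_deriv _ h2.hasDerivWithinAt h1] at h2

variable {x₀ : P} {m : ℕ} {σ : EuclideanSpace ℝ (Fin m) → P} {q : P → EuclideanSpace ℝ (Fin m)}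
  {B : Set (EuclideanSpace ℝ (Fin m))}

/-- The coordinates of a vector field along a plaque. -/
def IsPlaque.coord (h : IsPlaque x₀ σ q B) (X : AllVectorFields P) (y : P) :
    EuclideanSpace ℝ (Fin m) :=
  WithLp.toLp 2 fun i => (X.1 ⟨_, h.smooth i⟩ : P → ℝ) y

theorem IsPlaque.fderiv_coord (h : IsPlaque x₀ σ q B) {u : EuclideanSpace ℝ (Fin m)} (hu : u ∈ B)
    (i : Fin m) (b : EuclideanSpace ℝ (Fin m)) : fderiv ℝ (fun u' => q (σ u') i) u b = b i := by
  have h1 : (fun u' => q (σ u') i) =ᶠ[𝓝 u] fun u' => u' i := by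
    filter_upwards [h.isOpen.mem_nhds hu] with u' hu'
    rw [h.leftInv u' hu']
  rw [h1.fderiv_eq]
  have h2 : HasFDerivAt (fun u' : EuclideanSpace ℝ (Fin m) => u' i)
      (EuclideanSpace.proj i : EuclideanSpace ℝ (Fin m) →L[ℝ] ℝ) u :=
    (EuclideanSpace.proj i : EuclideanSpace ℝ (Fin m) →L[ℝ] ℝ).hasFDerivAt
  rw [h2.fderiv]
  rfl

theorem IsPlaque.tangentKer_eq_bot (h : IsPlaque x₀ σ q B) {u : EuclideanSpace ℝ (Fin m)}
    (hu : u ∈ B) : tangentKer σ u = ⊥ := by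
  rw [Submodule.eq_bot_iff]
  intro v hv
  ext i
  rw [← h.fderiv_coord hu i v]
  exact mem_tangentKer.1 hv _ (h.smooth i)

/-- Vector fields are tangent to plaques of maximal dimension: otherwise following the flow from
the points of a plaque would be an orbit map of larger rank. -/
theorem IsPlaque.derivation_apply (hP : IsSubcartesian P) (hm : IsRankBound x₀ m)
    (h : IsPlaque x₀ σ q B) (X : AllVectorFields P) {u : EuclideanSpace ℝ (Fin m)} (hu : u ∈ B)
    (f : SmoothFn P) : (X.1 f : P → ℝ) (σ u) =
      fderiv ℝ (fun u' => (f : P → ℝ) (σ u')) u (h.coord X (σ u)) := by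
  have hσ := h.isOrbitMapAt u hu
  have hσs := hσ.isSmoothIntoAt hP
  have hσ2 : IsOrbitMapAt x₀ (fun w : ℝ × EuclideanSpace ℝ (Fin m) => σ w.2) (0, u) :=
    IsOrbitMapAt.comp (ρ := fun w : ℝ × EuclideanSpace ℝ (Fin m) => w.2) hσ
      (Eventually.of_forall fun _ => contDiffAt_snd)
  obtain ⟨Γ, hΓ⟩ := (ExpRel.refl (X := X.1) (σ u)).exists_map hP X.2
    (hσ2.isSmoothIntoAt hP).continuousAt (τ := fun w : ℝ × EuclideanSpace ℝ (Fin m) => w.1)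
    continuous_fst.continuousAt
  have hΓo : IsOrbitMapAt x₀ Γ (0, u) :=
    hσ2.flow (Eventually.of_forall fun _ => contDiffAt_fst) hΓ
  have hΓs := hΓo.isSmoothIntoAt hP
  have hΓr : ∀ᶠ r : ℝ in 𝓝 0, ExpRel X.1 r (σ u) (Γ (r, u)) :=
    (by fun_prop : Continuous fun r : ℝ => (r, u)).continuousAt.eventually hΓ
  have hΓu : ∀ᶠ u' in 𝓝 u, Γ (0, u') = σ u' := by
    filter_upwards [(by fun_prop : Continuous fun u' : EuclideanSpace ℝ (Fin m) =>
      ((0 : ℝ), u')).continuousAt.eventually hΓ] with u' hu'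
    exact hu'.eq_of_zero
  -- The derivative of `Γ` at `(0, u)` combines the vector field and the derivative of `σ`.
  have hder : ∀ (g : SmoothFn P) (α : ℝ) (b : EuclideanSpace ℝ (Fin m)),
      fderiv ℝ (fun w => (g : P → ℝ) (Γ w)) (0, u) (α, b) =
        α * (X.1 g : P → ℝ) (σ u) + fderiv ℝ (fun u' => (g : P → ℝ) (σ u')) u b := by
    intro g α b
    have hd : HasFDerivAt (fun w => (g : P → ℝ) (Γ w)) _ (0, u) :=
      ((hΓs g g.2).differentiableAt (by simp)).hasFDerivAt
    have h1 : HasDerivAt (fun r : ℝ => (g : P → ℝ) (Γ (r, u))) _ 0 :=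
      HasFDerivAt.comp_hasDerivAt (l := fun w => (g : P → ℝ) (Γ w)) (f := fun r : ℝ => (r, u))
        (0 : ℝ) hd ((hasDerivAt_id (0 : ℝ)).prodMk (hasDerivAt_const (0 : ℝ) u))
    have h2 := h1.unique (hasDerivAt_comp_of_expRel hP X hΓr g h1.differentiableAt)
    have h3 : HasFDerivAt (fun u' => (g : P → ℝ) (Γ (0, u'))) _ u :=
      HasFDerivAt.comp (g := fun w => (g : P → ℝ) (Γ w)) (f := fun u' => ((0 : ℝ), u')) u hd
        (hasFDerivAt_prodMk_right (0 : ℝ) u)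
    have h4 : (fun u' => (g : P → ℝ) (σ u')) =ᶠ[𝓝 u] fun u' => (g : P → ℝ) (Γ (0, u')) :=
      hΓu.mono fun u' hu' => congrArg (g : P → ℝ) hu'.symm
    rw [h4.fderiv_eq, h3.fderiv, ← h2]
    have h5 : ((α, b) : ℝ × EuclideanSpace ℝ (Fin m)) = α • (1, 0) + (0, b) := by simp
    rw [h5, map_add, map_smul, smul_eq_mul]
    rfl
  have hrank := hm _ Γ (0, u) hΓo
  rw [Module.finrank_prod, Module.finrank_self, finrank_euclideanSpace_fin] at hrank
  obtain ⟨⟨⟨α, b⟩, hmem⟩, hne⟩ := Module.finrank_pos_iff_exists_ne_zero.1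
    (by omega : 0 < Module.finrank ℝ (tangentKer Γ (0, u)))
  rw [mem_tangentKer] at hmem
  -- The kernel vector `(α, b)` involves the flow direction, as `σ` is an immersion.
  have hα : α ≠ 0 := by
    rintro rfl
    refine hne (Subtype.ext (Prod.ext rfl ?_))
    ext i
    have h1 := hmem _ (h.smooth i)
    rw [hder ⟨_, h.smooth i⟩, zero_mul, zero_add, h.fderiv_coord hu] at h1
    exact h1
  have hb : h.coord X (σ u) = -α⁻¹ • b := by
    ext i
    have h1 := hmem _ (h.smooth i)
    rw [hder ⟨_, h.smooth i⟩, h.fderiv_coord hu] at h1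
    have h2 : h.coord X (σ u) i = (X.1 ⟨_, h.smooth i⟩ : P → ℝ) (σ u) := rfl
    rw [h2, PiLp.smul_apply, smul_eq_mul]
    field_simp
    linarith
  have h1 := hmem _ f.2
  rw [hder f] at h1
  rw [hb, map_smul, smul_eq_mul]
  field_simp
  linarith

/-- Integral curves starting on a plaque of maximal dimension stay in it for a short time. -/
theorem IsPlaque.exists_flow (hP : IsSubcartesian P) (hm : IsRankBound x₀ m)
    (h : IsPlaque x₀ σ q B) (X : AllVectorFields P) {u₀ : EuclideanSpace ℝ (Fin m)}
    (hu₀ : u₀ ∈ B) : ∃ Θ : ℝ × EuclideanSpace ℝ (Fin m) → EuclideanSpace ℝ (Fin m),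
      ContinuousAt Θ (0, u₀) ∧ Θ (0, u₀) = u₀ ∧
        ∀ᶠ w in 𝓝 (0, u₀), ∀ y, ExpRel X.1 w.1 (σ w.2) y → y = σ (Θ w) := by
  obtain ⟨W, hW, hWc, hWe⟩ := exists_contDiff_hasCompactSupport_eventuallyEq h.isOpen
    (k := fun u => h.coord X (σ u)) (fun u hu => (PiLp.contDiff_toLp).contDiffAt.comp u
      (contDiffAt_pi.2 fun i =>
        (h.isOrbitMapAt u hu).isSmoothIntoAt hP _ (X.1 ⟨_, h.smooth i⟩).2)) hu₀
  obtain ⟨ε, hε, Θ, hΘ, hex, huniq⟩ := exists_smooth_flow hW hWc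
  have hΘc : ContinuousAt Θ (0, u₀) := (hΘ 0 u₀ (by simpa using hε)).continuousAt
  have hΘ0 : Θ (0, u₀) = u₀ := by
    obtain ⟨c, hc0, hc1, -⟩ := hex 0 u₀ (by simpa using hε)
    exact hc1.symm.trans hc0
  have hΘt : Tendsto Θ (𝓝 (0, u₀)) (𝓝 u₀) := by
    have := hΘc.tendsto
    rwa [hΘ0] at this
  have hgood : ∀ᶠ w in 𝓝 (0, u₀), W (Θ w) = h.coord X (σ (Θ w)) ∧ Θ w ∈ B :=
    (hΘt.eventually hWe).and (hΘt.eventually (h.isOpen.mem_nhds hu₀))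
  rw [nhds_prod_eq, eventually_prod_iff] at hgood
  obtain ⟨p₁, hp₁, p₂, hp₂, hgood⟩ := hgood
  obtain ⟨δ, hδ, hδp⟩ := Metric.eventually_nhds_iff.1 hp₁
  refine ⟨Θ, hΘc, hΘ0, ?_⟩
  rw [nhds_prod_eq]
  refine eventually_prod_iff.2 ⟨fun r => |r| < min ε δ, ?_, p₂, hp₂, fun {r} hr {u} hu y hy => ?_⟩
  · filter_upwards [Metric.ball_mem_nhds (0 : ℝ) (lt_min hε hδ)] with r hr
    rwa [mem_ball_zero_iff, Real.norm_eq_abs] at hr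
  replace hr : |r| < ε ∧ |r| < δ := lt_min_iff.1 hr
  obtain ⟨c, hc0, hc1, hcd⟩ := hex r u hr.1
  have hsr : ∀ s ∈ uIcc 0 r, |s| ≤ |r| := by
    intro s hs
    simpa using abs_sub_left_of_mem_uIcc hs
  have hcΘ : ∀ s ∈ uIcc 0 r, c s = Θ (s, u) := by
    intro s hs
    have hsub : uIcc 0 s ⊆ uIcc 0 r := uIcc_subset_uIcc_left hs
    exact huniq s u ((hsr s hs).trans_lt hr.1) c hc0
      fun a ha => (hcd a (hsub ha)).mono hsub
  have hcg : ∀ s ∈ uIcc 0 r, W (c s) = h.coord X (σ (c s)) ∧ c s ∈ B := by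
    intro s hs
    rw [hcΘ s hs]
    refine hgood (hδp ?_) hu
    rw [Real.dist_eq, sub_zero]
    exact (hsr s hs).trans_lt hr.2
  have hexp : ExpRel X.1 r (σ u) (σ (c r)) := by
    refine ⟨fun s => σ (c s), isIntegralCurveOfDerivation_of_hasDerivWithinAt fun f s hs => ?_,
      by simp only [hc0], rfl⟩
    obtain ⟨h1, h2⟩ := hcg s hs
    have h3 : HasFDerivAt (fun u' => (f : P → ℝ) (σ u')) _ (c s) :=
      (((h.isOrbitMapAt _ h2).isSmoothIntoAt hP f f.2).differentiableAt (by simp)).hasFDerivAt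
    have h4 := h3.comp_hasDerivWithinAt s (hcd s hs)
    rw [h.derivation_apply hP hm X h2 f]
    rw [h1] at h4
    exact h4
  rw [hy.unique hP X.2 hexp, hc1]

/-- The same for an immersive orbit map of maximal rank, in terms of its own parameters. -/
theorem exists_flow_in_orbitMap (hP : IsSubcartesian P) (hm : IsRankBound x₀ m)
    {u₀ : EuclideanSpace ℝ (Fin m)} (hσ : IsOrbitMapAt x₀ σ u₀) (hker : tangentKer σ u₀ = ⊥)
    (X : AllVectorFields P) :
    ∃ Θ : ℝ × EuclideanSpace ℝ (Fin m) → EuclideanSpace ℝ (Fin m),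
      ContinuousAt Θ (0, u₀) ∧ Θ (0, u₀) = u₀ ∧
        ∀ᶠ w in 𝓝 (0, u₀), ∀ y, ExpRel X.1 w.1 (σ w.2) y → y = σ (Θ w) := by
  obtain ⟨q, B, κ, hpl, hB, hκ, hq, hκq⟩ := exists_isPlaque hP hσ hker
  obtain ⟨Θ, hΘ, hΘ0, hΘe⟩ := hpl.exists_flow hP hm X hB
  have ht : ContinuousAt (fun w : ℝ × EuclideanSpace ℝ (Fin m) => (w.1, q (σ w.2))) (0, u₀) :=
    continuousAt_fst.prodMk (ContinuousAt.comp (g := fun u' => q (σ u')) (f := Prod.snd)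
      (x := ((0 : ℝ), u₀)) hq continuousAt_snd)
  refine ⟨fun w => κ (Θ (w.1, q (σ w.2))), ?_, ?_, ?_⟩
  · refine ContinuousAt.comp (g := κ) (f := fun w : ℝ × EuclideanSpace ℝ (Fin m) =>
      Θ (w.1, q (σ w.2))) (x := (0, u₀)) ?_ (ContinuousAt.comp (g := Θ)
        (f := fun w : ℝ × EuclideanSpace ℝ (Fin m) => (w.1, q (σ w.2))) (x := (0, u₀)) hΘ ht)
    simpa only [hΘ0] using hκ
  · simp only [hΘ0]
    exact hκq.self_of_nhds
  · filter_upwards [ht.eventually hΘe, continuousAt_snd.eventually hκq] with w h1 h2 y hy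
    refine h1 y ?_
    simp only [h2]
    exact hy

/-- Composed flows which reach a point of an immersive orbit map of maximal rank stay in its image
when the times are varied a little. This is what makes plaques open in the manifold topology. -/
theorem exists_composedFlow_in_orbitMap (hP : IsSubcartesian P) (hm : IsRankBound x₀ m) (k : ℕ)
    (X : Fin k → AllVectorFields P) (t : Fin k → ℝ) {σ : EuclideanSpace ℝ (Fin m) → P}
    {u₀ : EuclideanSpace ℝ (Fin m)} (hσ : IsOrbitMapAt x₀ σ u₀) (hker : tangentKer σ u₀ = ⊥)
    (h : ComposedExpRel k X t x₀ (σ u₀)) :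
    ∃ υ : (Fin k → ℝ) → EuclideanSpace ℝ (Fin m), ContinuousAt υ t ∧ υ t = u₀ ∧
      ∀ᶠ s in 𝓝 t, ∀ z, ComposedExpRel k X s x₀ z → z = σ (υ s) := by
  induction k generalizing σ with
  | zero =>
    refine ⟨fun _ => u₀, continuousAt_const, rfl, Eventually.of_forall fun s z hz => ?_⟩
    exact Eq.trans hz (Eq.symm h)
  | succ k ih =>
    obtain ⟨w, hw, hwσ⟩ := h
    have hσs := hσ.isSmoothIntoAt hP
    obtain ⟨σ₁, hσ₁⟩ := hwσ.symm.exists_map hP (X 0).2 hσs.continuousAt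
      (τ := fun _ => -t 0) continuousAt_const
    obtain rfl := (hσ₁.self_of_nhds).unique hP (X 0).2 hwσ.symm
    have hσ₁o : IsOrbitMapAt x₀ σ₁ u₀ :=
      hσ.flow (Eventually.of_forall fun _ => contDiffAt_const) hσ₁
    have hker₁ : tangentKer σ₁ u₀ = ⊥ := by
      rw [← hker]
      refine tangentKer_composedFlow hP (X := fun _ : Fin 1 => X 0) (t := fun _ => -t 0) hσs ?_
      exact hσ₁.mono fun u hu => ⟨σ u, rfl, hu⟩
    obtain ⟨υ, hυ, hυt, hυe⟩ := ih (Fin.tail X) (Fin.tail t) hσ₁o hker₁ hw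
    obtain ⟨Θ, hΘ, hΘ0, hΘe⟩ := exists_flow_in_orbitMap hP hm hσ hker (X 0)
    have htail : ContinuousAt (fun s : Fin (k + 1) → ℝ => Fin.tail s) t :=
      continuousAt_pi.2 fun i => (continuous_apply i.succ).continuousAt
    have hυ' : Tendsto (fun s : Fin (k + 1) → ℝ => υ (Fin.tail s)) (𝓝 t) (𝓝 u₀) := by
      have h1 := hυ.tendsto.comp htail
      rwa [hυt] at h1
    have hts : Tendsto (fun s : Fin (k + 1) → ℝ => (s 0 - t 0, υ (Fin.tail s))) (𝓝 t)
        (𝓝 (0, u₀)) := by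
      refine Tendsto.prodMk_nhds ?_ hυ'
      have h1 : Continuous fun s : Fin (k + 1) → ℝ => s 0 - t 0 := by fun_prop
      have h2 := h1.tendsto t
      rwa [sub_self] at h2
    refine ⟨fun s => Θ (s 0 - t 0, υ (Fin.tail s)), ?_, ?_, ?_⟩
    · have h1 := hΘ.tendsto.comp hts
      rw [ContinuousAt]
      simpa only [sub_self, hυt, Function.comp_def] using h1
    · simp only [sub_self, hυt, hΘ0]
    · filter_upwards [htail.eventually hυe, hts.eventually hΘe, hυ'.eventually hσ₁]
        with s h1 h2 h3 z hz
      obtain ⟨v, hv, hvz⟩ := hz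
      obtain rfl := h1 v hv
      refine h2 z ?_
      have h4 := h3.trans hP (X 0).2 hvz
      rwa [neg_add_eq_sub] at h4

end Plaques

/-! ### The manifold structure of an orbit -/

section OrbitManifold

variable {P : Type*} [TopologicalSpace P] [DifferentialSpace P]

theorem OrbitSpace.isOpen_iff {x₀ : P} {A : Set (OrbitSpace x₀)} : IsOpen A ↔
    ∀ (k : ℕ) (X : Fin k → AllVectorFields P) (t : Fin k → ℝ),
      (∃ z ∈ A, ComposedExpRel k X t x₀ (incl x₀ z)) →
        ∀ᶠ s in 𝓝 t, ∀ z, ComposedExpRel k X s x₀ (incl x₀ z) → z ∈ A := Iff.rfl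

/-- The manifold topology is finer than the subspace topology. -/
theorem OrbitSpace.continuous_incl (hP : IsSubcartesian P) (x₀ : P) : Continuous (incl x₀) := by
  refine continuous_def.2 fun V hV => isOpen_iff.2 fun k X t => ?_
  rintro ⟨z, hzV, hz⟩
  obtain ⟨ψ, hψ, hψe⟩ := ComposedExpRel.exists_map hP (ψ := fun _ : Fin k → ℝ => x₀)
    (τ := fun s => s) continuousAt_const continuousAt_id hz
  have h1 := (hψe.self_of_nhds).unique hP hz
  have h2 : ∀ᶠ s in 𝓝 t, ψ s ∈ V := hψ.eventually (hV.mem_nhds (by rw [h1]; exact hzV))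
  filter_upwards [h2, hψe] with s hs hs' w hw
  rw [mem_preimage, hw.unique hP hs']
  exact hs

/-- Orbit maps are continuous for the manifold topology. -/
theorem OrbitSpace.tendsto_of_isOrbitMapAt {E : Type*} [NormedAddCommGroup E] [NormedSpace ℝ E]
    {x₀ : P} {ψ : E → OrbitSpace x₀} {e : E} (h : IsOrbitMapAt x₀ (fun e' => incl x₀ (ψ e')) e) :
    Tendsto ψ (𝓝 e) (𝓝 (ψ e)) := by
  obtain ⟨k, X, τ, hτ, h⟩ := h
  intro A hA
  obtain ⟨A', hA', hAo, heA⟩ := mem_nhds_iff.1 hA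
  have h1 := OrbitSpace.isOpen_iff.1 hAo k X (τ e) ⟨_, heA, h.self_of_nhds⟩
  change ∀ᶠ e' in 𝓝 e, ψ e' ∈ A
  filter_upwards [hτ.self_of_nhds.continuousAt.eventually h1, h] with e' h2 h3
  exact hA' (h2 _ h3)

/-- Integral curves of vector fields are continuous for the manifold topology, so a flow does not
leave the connected component. -/
theorem OrbitSpace.mem_connectedComponent_of_expRel {x₀ : P}
    {X : AllVectorFields P} {t : ℝ} {z z' : OrbitSpace x₀}
    (h : ExpRel X.1 t (incl x₀ z) (incl x₀ z')) : z' ∈ connectedComponent z := by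
  obtain ⟨c, hc, hc0, hct⟩ := h
  have hmem : ∀ r : uIcc 0 t, c r ∈ vfOrbit x₀ := by
    intro r
    have h1 := hc.expRel left_mem_uIcc r.2
    rw [hc0] at h1
    exact h1.mem_vfOrbit z.2
  let γ : uIcc 0 t → OrbitSpace x₀ := fun r => ⟨c r, hmem r⟩
  have hγ : Continuous γ := by
    refine continuous_iff_continuousAt.2 fun a A hA => ?_
    obtain ⟨A', hA', hAo, haA⟩ := mem_nhds_iff.1 hA
    obtain ⟨k, Y, s, hs⟩ := hmem a
    have h1 := OrbitSpace.isOpen_iff.1 hAo (k + 1) (Fin.cons X Y) (Fin.cons 0 s)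
      ⟨_, haA, composedExpRel_cons.2 ⟨c a, hs, ExpRel.refl _⟩⟩
    have h2 : Tendsto (fun r : uIcc 0 t => (Fin.cons ((r : ℝ) - a) s : Fin (k + 1) → ℝ)) (𝓝 a)
        (𝓝 (Fin.cons 0 s)) := by
      refine tendsto_pi_nhds.2 fun i => Fin.cases ?_ (fun j => tendsto_const_nhds) i
      have h3 : Continuous fun r : uIcc 0 t => (r : ℝ) - a := by fun_prop
      have h4 := h3.tendsto a
      rwa [sub_self] at h4
    change ∀ᶠ r in 𝓝 a, γ r ∈ A
    filter_upwards [h2.eventually h1] with r hr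
    exact hA' (hr (γ r) (composedExpRel_cons.2 ⟨c a, hs, hc.expRel a.2 r.2⟩))
  have hpre : PreconnectedSpace (uIcc 0 t) :=
    isPreconnected_iff_preconnectedSpace.1 isPreconnected_uIcc
  have h0 : γ ⟨0, left_mem_uIcc⟩ = z := Subtype.ext hc0
  have h1 : γ ⟨t, right_mem_uIcc⟩ = z' := Subtype.ext hct
  exact (isPreconnected_range hγ).subset_connectedComponent ⟨_, h0⟩ ⟨_, h1⟩

/-- Every point of an orbit is joined to the base point by finitely many integral curves. -/
theorem OrbitSpace.connectedSpace (x₀ : P) :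
    ConnectedSpace (OrbitSpace x₀) := by
  let b : OrbitSpace x₀ := ⟨x₀, self_mem_vfOrbit x₀⟩
  have key : ∀ (k : ℕ) (X : Fin k → AllVectorFields P) (t : Fin k → ℝ) (z : OrbitSpace x₀),
      ComposedExpRel k X t x₀ (incl x₀ z) → z ∈ connectedComponent b := by
    intro k
    induction k with
    | zero =>
      intro X t z hz
      have : z = b := Subtype.ext hz
      rw [this]
      exact mem_connectedComponent
    | succ k ih =>
      rintro X t z ⟨w, hw, hz⟩
      have h1 := ih _ _ (⟨w, _, _, _, hw⟩ : OrbitSpace x₀) hw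
      rw [connectedComponent_eq h1]
      exact mem_connectedComponent_of_expRel hz
  have : PreconnectedSpace (OrbitSpace x₀) := ⟨isPreconnected_of_forall b fun z _ =>
    ⟨connectedComponent b, subset_univ _, mem_connectedComponent, by
      obtain ⟨k, X, t, h⟩ := z.2
      exact key k X t z h, isPreconnected_connectedComponent⟩⟩
  exact ⟨⟨b⟩⟩

variable {x₀ : P} {m : ℕ} {σ : EuclideanSpace ℝ (Fin m) → P} {q : P → EuclideanSpace ℝ (Fin m)}
  {B : Set (EuclideanSpace ℝ (Fin m))}

open Classical in
/-- The parametrization of a plaque, as a map to the orbit. Parameters outside the domain of the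
plaque may be mapped to the base point. -/
def orbitParam (x₀ : P) (σ : EuclideanSpace ℝ (Fin m) → P) (u : EuclideanSpace ℝ (Fin m)) :
    OrbitSpace x₀ :=
  if h : σ u ∈ vfOrbit x₀ then ⟨σ u, h⟩ else ⟨x₀, self_mem_vfOrbit x₀⟩

theorem IsPlaque.incl_orbitParam (h : IsPlaque x₀ σ q B) {u : EuclideanSpace ℝ (Fin m)}
    (hu : u ∈ B) : OrbitSpace.incl x₀ (orbitParam x₀ σ u) = σ u := by
  exact congrArg (OrbitSpace.incl x₀) (dif_pos (h.isOrbitMapAt u hu).mem_vfOrbit)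

/-- The chart of an orbit defined by a plaque of maximal dimension. -/
def IsPlaque.chart (hP : IsSubcartesian P) (hm : IsRankBound x₀ m) (h : IsPlaque x₀ σ q B) :
    OpenPartialHomeomorph (OrbitSpace x₀) (EuclideanSpace ℝ (Fin m)) where
  toFun z := q (OrbitSpace.incl x₀ z)
  invFun := orbitParam x₀ σ
  source := {z | q (OrbitSpace.incl x₀ z) ∈ B ∧
    σ (q (OrbitSpace.incl x₀ z)) = OrbitSpace.incl x₀ z}
  target := B
  map_source' z hz := hz.1
  map_target' u hu := by
    rw [mem_ofPred_eq, h.incl_orbitParam hu, h.leftInv u hu]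
    exact ⟨hu, rfl⟩
  left_inv' z hz := Subtype.ext ((h.incl_orbitParam hz.1).trans hz.2)
  right_inv' u hu := by rw [h.incl_orbitParam hu, h.leftInv u hu]
  open_source := by
    refine OrbitSpace.isOpen_iff.2 fun k X t => ?_
    rintro ⟨z, ⟨hzB, hz⟩, hzt⟩
    rw [← hz] at hzt
    obtain ⟨υ, hυ, hυt, hυe⟩ := exists_composedFlow_in_orbitMap hP hm k X t
      (h.isOrbitMapAt _ hzB) (h.tangentKer_eq_bot hzB) hzt
    filter_upwards [hυe, hυ.eventually (h.isOpen.mem_nhds (by rw [hυt]; exact hzB))]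
      with s hs hsB w hw
    rw [hs _ hw, h.leftInv _ hsB]
    exact ⟨hsB, rfl⟩
  open_target := h.isOpen
  continuousOn_toFun := by
    have hq : Continuous q := (PiLp.continuous_toLp 2 fun _ : Fin m => ℝ).comp
      (continuous_pi fun i => SmoothFn.continuous (h.smooth i))
    exact (hq.comp (OrbitSpace.continuous_incl hP x₀)).continuousOn
  continuousOn_invFun u hu := by
    refine ContinuousAt.continuousWithinAt (OrbitSpace.tendsto_of_isOrbitMapAt ?_)
    obtain ⟨k, X, τ, hτ, hσ⟩ := h.isOrbitMapAt u hu
    refine ⟨k, X, τ, hτ, ?_⟩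
    filter_upwards [hσ, h.isOpen.mem_nhds hu] with u' h1 h2
    rwa [h.incl_orbitParam h2]

/-- **Orbit theorem.** Every orbit, with its manifold topology, is a smooth manifold, and its
inclusion is a smooth immersion. The charts are the plaques of maximal dimension. -/
theorem isSmoothManifoldVia_incl (hP : IsSubcartesian P) (x₀ : P) :
    IsSmoothManifoldVia (OrbitSpace.incl x₀) := by
  obtain ⟨m, hm, hσ⟩ := exists_dimension hP x₀
  have hpl : ∀ z : OrbitSpace x₀, ∃ (σ : EuclideanSpace ℝ (Fin m) → P)
      (q : P → EuclideanSpace ℝ (Fin m)) (B : Set (EuclideanSpace ℝ (Fin m)))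
      (h : IsPlaque x₀ σ q B), z ∈ (h.chart hP hm).source := by
    intro z
    obtain ⟨σ, hσo, hσz, hker⟩ := hσ (OrbitSpace.incl x₀ z) z.2
    obtain ⟨q, B, κ, h, hB, -, -, hκ⟩ := exists_isPlaque hP hσo hker
    refine ⟨_, q, B, h, ?_⟩
    have h1 : q (OrbitSpace.incl x₀ z) ∈ B ∧
        σ (κ (q (OrbitSpace.incl x₀ z))) = OrbitSpace.incl x₀ z := by
      rw [← hσz, hκ.self_of_nhds]
      exact ⟨hB, rfl⟩
    exact h1
  choose σ q B h hz using hpl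
  let cs : ChartedSpace (EuclideanSpace ℝ (Fin m)) (OrbitSpace x₀) :=
    { atlas := range fun z => (h z).chart hP hm
      chartAt := fun z => (h z).chart hP hm
      mem_chart_source := hz
      chart_mem_atlas := fun z => mem_range_self z }
  have hq : ∀ (z : OrbitSpace x₀) (ψ : EuclideanSpace ℝ (Fin m) → P)
      (u : EuclideanSpace ℝ (Fin m)), IsSmoothIntoAt ψ u →
      ContDiffAt ℝ ∞ (fun u' => q z (ψ u')) u := fun z ψ u hψ =>
    (PiLp.contDiff_toLp).contDiffAt.comp u (contDiffAt_pi.2 fun i => hψ _ ((h z).smooth i))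
  have : IsManifold (𝓡 m) ∞ (OrbitSpace x₀) := by
    refine isManifold_of_contDiffOn _ _ _ ?_
    rintro _ _ ⟨z, rfl⟩ ⟨z', rfl⟩
    intro u hu
    have huB : u ∈ B z := by
      have h0 : u ∈ ((h z).chart hP hm).target := by simpa using hu.1.1
      exact h0
    refine ContDiffAt.contDiffWithinAt ?_
    have h1 := hq z' (σ z) u (((h z).isOrbitMapAt u huB).isSmoothIntoAt hP)
    refine h1.congr_of_eventuallyEq ?_
    filter_upwards [(h z).isOpen.mem_nhds huB] with v hv
    exact congrArg (q z') ((h z).incl_orbitParam hv)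
  refine ⟨m, cs, this, fun f hf z => ?_, fun k hk z => ?_⟩
  · have h1 : ContMDiffAt (𝓡 m) 𝓘(ℝ, ℝ) ∞ (fun u => f (σ z u)) (chartAt _ z z) :=
      (((h z).isOrbitMapAt _ (hz z).1).isSmoothIntoAt hP f hf).contMDiffAt
    have h2 : ContMDiffAt (𝓡 m) (𝓡 m) ∞ (chartAt (EuclideanSpace ℝ (Fin m)) z) z :=
      contMDiffAt_of_mem_maximalAtlas (IsManifold.chart_mem_maximalAtlas z)
        (mem_chart_source _ z)
    refine (h1.comp z h2).congr_of_eventuallyEq ?_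
    filter_upwards [((h z).chart hP hm).open_source.mem_nhds (hz z)] with w hw
    exact congrArg f hw.2.symm
  · have h1 : ContMDiffOn (𝓡 m) 𝓘(ℝ, ℝ) ∞
        (k ∘ (chartAt (EuclideanSpace ℝ (Fin m)) z).symm)
        (chartAt (EuclideanSpace ℝ (Fin m)) z).target :=
      hk.comp_contMDiffOn contMDiffOn_chart_symm
    rw [contMDiffOn_iff_contDiffOn] at h1
    have h2 : ∀ u ∈ B z, ContDiffAt ℝ ∞ (fun u => k (orbitParam x₀ (σ z) u)) u := fun u hu =>
      h1.contDiffAt ((h z).isOpen.mem_nhds hu)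
    obtain ⟨K, hK, -, hKe⟩ :=
      exists_contDiff_hasCompactSupport_eventuallyEq (h z).isOpen h2 (hz z).1
    refine ⟨fun y => K (q z y), SmoothFn.comp_contDiff (h z).smooth
      (F := fun v => K (WithLp.toLp 2 v)) (hK.comp PiLp.contDiff_toLp), ?_⟩
    have h3 : ContinuousAt (fun w => q z (OrbitSpace.incl x₀ w)) z :=
      ((h z).chart hP hm).continuousAt (hz z)
    filter_upwards [h3.eventually hKe, ((h z).chart hP hm).open_source.mem_nhds (hz z)]
      with w hw hws
    rw [hw]
    exact congrArg k (((h z).chart hP hm).left_inv hws).symm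

end OrbitManifold

theorem theorem1 {P : Type*} [TopologicalSpace P] [DifferentialSpace P] (hP : IsSubcartesian P)
    (hfin : LocallyFinite (fun O : vfOrbits P => (O : Set P)))
    (hclosed : ∀ O ∈ vfOrbits P, IsLocallyClosed O) :
    (Setoid.IsPartition (vfOrbits P) ∧
      (∀ x : P, ConnectedSpace (OrbitSpace x) ∧ Continuous (OrbitSpace.incl x) ∧
        IsSmoothManifoldVia (OrbitSpace.incl x)) ∧
      FrontierCondition (vfOrbits P)) ∧
    ((∀ x : P, IsEmbedding (OrbitSpace.incl x)) → IsSmoothStratification (vfOrbits P)) := by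
  refine ⟨⟨isPartition_vfOrbits, fun x => ⟨OrbitSpace.connectedSpace x,
    OrbitSpace.continuous_incl hP x, isSmoothManifoldVia_incl hP x⟩,
    frontierCondition_vfOrbits hP⟩, fun hemb => ?_⟩
  refine { isPartition := isPartition_vfOrbits
           locallyFinite := hfin
           isLocallyClosed := hclosed
           isManifold := ?_
           frontier := frontierCondition_vfOrbits hP
           isConnected := ?_ }
  · rintro _ ⟨x, rfl⟩
    have h := isSmoothManifoldVia_incl hP x
    -- The two topologies on the orbit are equal, so the manifold structure can be transferred.
    have htop : OrbitSpace.instTopologicalSpace x =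
        (instTopologicalSpaceSubtype : TopologicalSpace (vfOrbit x)) := (hemb x).eq_induced
    revert h
    unfold IsSmoothManifoldVia
    rw [htop]
    exact id
  · rintro _ ⟨x, rfl⟩
    have := OrbitSpace.connectedSpace x
    have h := isConnected_range (OrbitSpace.continuous_incl hP x)
    rwa [show range (OrbitSpace.incl x) = vfOrbit x from Subtype.range_coe] at h

end
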